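/- Here $\log=\log_2$ and $0\log 0=0$. Running times are measured on unit-cost random access machines (addition, subtraction, indirect addressing). (1) *Locating-Dominating Set.* A locating-dominating set of a finite simple graph $G$ is a set $S\subseteq V(G)$ such that every vertex outside $S$ has a neighbour in $S$, and $N(u)\cap S\neq N(v)\cap S$ for any two distinct vertices $u,v\in V(G)\setminus S$. There is an algorithm which, given a finite simple graph $G$ on $n$ vertices (by its adjacency matrix) and an integer $k\ge 0$, decides whether $G$ has a locating-dominating set of size $k$ in time $2^{O(\mathsf{vc}\log \mathsf{vc})}\cdot n^{O(1)}$, where $\mathsf{vc}$ is the vertex cover number of $G$; precisely, there is a constant $c$, independent of the input, such that the running time is at most $c\cdot 2^{c\,\mathsf{vc}\log \mathsf{vc}}\cdot (n+1)^{c}$. The number $\mathsf{vc}$ is not part of the input. (2) *Test Cover.* There is an algorithm which, given a finite set $U$ of items, a finite collection $\mathcal F$ of subsets of $U$ (called tests; given by their incidence matrix with the items) and an integer $k\ge 0$, decides whether there are at most $k$ tests in $\mathcal F$ such that for every pair of distinct items some chosen test contains exactly one of the two, in time $2^{O(|U|\log|U|)}\cdot(|U|+|\mathcal F|)^{O(1)}$;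 precisely, there is a constant $c$, independent of the input, such that the running time is at most $c\cdot 2^{c\,|U|\log|U|}\cdot (|U|+|\mathcal F|+1)^{c}$. -/

import Mathlib

/-!
## Random access machines

Programs of a unit-cost random access machine over the natural numbers. A machine has variables
`x₀, x₁, …` and arrays `A₀, A₁, …` whose entries are addressed indirectly, through computed
indices; a program is a finite object and mentions only finitely many variables and arrays. The
arithmetic operations are addition and truncated subtraction only (no multiplication), so that unit
cost is polynomially related to the running time of Turing machines. Control flow is structured
(composition, branching, while loops) instead of being given by jumps.
-/

namespace RAM

/-- A memory state: the values of the variables and the contents of the arrays. -/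
@[ext] structure State where
  var : ℕ → ℕ
  arr : ℕ → ℕ → ℕ

/-- Arithmetic expressions; `get A i` is the entry of the array `A` at the index `i`. -/
inductive Expr where
  | const (c : ℕ)
  | var (x : ℕ)
  | add (a b : Expr)
  | sub (a b : Expr)
  | get (A : ℕ) (i : Expr)

/-- The value of an expression. -/
def Expr.eval (s : State) : Expr → ℕ
  | const c => c
  | var x => s.var x
  | add a b => a.eval s + b.eval s
  | sub a b => a.eval s - b.eval s
  | get A i => s.arr A (i.eval s)

/-- The time needed to evaluate an expression: one unit for every constant, variable, arithmetic
operation and array access in it. -/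
def Expr.cost : Expr → ℕ
  | const _ => 1
  | var _ => 1
  | add a b => a.cost + b.cost + 1
  | sub a b => a.cost + b.cost + 1
  | get _ i => i.cost + 1

/-- Programs. A condition `e` holds if its value is not zero. -/
inductive Prog where
  | skip
  /-- `x := e` -/
  | assign (x : ℕ) (e : Expr)
  /-- `A[i] := e` -/
  | store (A : ℕ) (i e : Expr)
  | seq (p q : Prog)
  | ite (e : Expr) (p q : Prog)
  | while (e : Expr) (p : Prog)

/-- The state after `x := v`. -/
def State.setVar (s : State) (x v : ℕ) : State where
  var := Function.update s.var x v
  arr := s.arr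

/-- The state after `A[i] := v`. -/
def State.setArr (s : State) (A i v : ℕ) : State where
  var := s.var
  arr := Function.update s.arr A (Function.update (s.arr A) i v)

/-- `Exec p s t s'`: the program `p`, started in the state `s`, terminates after `t` time units in
the state `s'`. -/
inductive Exec : Prog → State → ℕ → State → Prop where
  | skip (s : State) : Exec .skip s 1 s
  | assign (x : ℕ) (e : Expr) (s : State) :
      Exec (.assign x e) s (e.cost + 1) (s.setVar x (e.eval s))
  | store (A : ℕ) (i e : Expr) (s : State) :
      Exec (.store A i e) s (i.cost + e.cost + 1) (s.setArr A (i.eval s) (e.eval s))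
  | seq {p q : Prog} {s s' s'' : State} {t t' : ℕ} :
      Exec p s t s' → Exec q s' t' s'' → Exec (.seq p q) s (t + t') s''
  | iteTrue {e : Expr} {p q : Prog} {s s' : State} {t : ℕ} :
      e.eval s ≠ 0 → Exec p s t s' → Exec (.ite e p q) s (e.cost + 1 + t) s'
  | iteFalse {e : Expr} {p q : Prog} {s s' : State} {t : ℕ} :
      e.eval s = 0 → Exec q s t s' → Exec (.ite e p q) s (e.cost + 1 + t) s'
  | whileTrue {e : Expr} {p : Prog} {s s' s'' : State} {t t' : ℕ} :
      e.eval s ≠ 0 → Exec p s t s' → Exec (.while e p) s' t' s'' →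
      Exec (.while e p) s (e.cost + 1 + t + t') s''
  | whileFalse {e : Expr} {p : Prog} {s : State} :
      e.eval s = 0 → Exec (.while e p) s (e.cost + 1) s

/-- The machine is deterministic. -/
theorem Exec.deterministic {p : Prog} {s s₁ s₂ : State} {t₁ t₂ : ℕ}
    (h₁ : Exec p s t₁ s₁) (h₂ : Exec p s t₂ s₂) : t₁ = t₂ ∧ s₁ = s₂ := by
  induction h₁ generalizing t₂ s₂ with
  | skip s => cases h₂; exact ⟨rfl, rfl⟩
  | assign x e s => cases h₂; exact ⟨rfl, rfl⟩
  | store A i e s => cases h₂; exact ⟨rfl, rfl⟩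
  | seq _ _ ih ih' =>
    cases h₂ with
    | seq g g' =>
      obtain ⟨rfl, rfl⟩ := ih g
      obtain ⟨rfl, rfl⟩ := ih' g'
      exact ⟨rfl, rfl⟩
  | iteTrue he _ ih =>
    cases h₂ with
    | iteTrue _ g => obtain ⟨rfl, rfl⟩ := ih g; exact ⟨rfl, rfl⟩
    | iteFalse he' _ => exact absurd he' he
  | iteFalse he _ ih =>
    cases h₂ with
    | iteTrue he' _ => exact absurd he he'
    | iteFalse _ g => obtain ⟨rfl, rfl⟩ := ih g; exact ⟨rfl, rfl⟩
  | whileTrue he _ _ ih ih' =>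
    cases h₂ with
    | whileTrue _ g g' =>
      obtain ⟨rfl, rfl⟩ := ih g
      obtain ⟨rfl, rfl⟩ := ih' g'
      exact ⟨rfl, rfl⟩
    | whileFalse he' => exact absurd he' he
  | whileFalse he =>
    cases h₂ with
    | whileTrue he' _ _ => exact absurd he he'
    | whileFalse _ => exact ⟨rfl, rfl⟩

/-- The initial state: the input is written in the array `0`; everything else is zero. -/
def State.init (input : List ℕ) : State where
  var _ := 0
  arr A i := if A = 0 then input.getD i 0 else 0

/-- On the given input, the program terminates within time `T` and reports (in the variable `0`)
whether the proposition `answer` holds: `1` if it does, `0` if it does not. -/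
def Prog.DecidesInTime (P : Prog) (input : List ℕ) (answer : Prop) (T : ℝ) : Prop :=
  ∃ (t : ℕ) (s : State), Exec P (State.init input) t s ∧ (t : ℝ) ≤ T ∧
    (answer → s.var 0 = 1) ∧ (¬ answer → s.var 0 = 0)

end RAM

/-! ## Locating-dominating sets -/

/-- `S` is a dominating set of `G`: every vertex is in `S` or has a neighbour in `S`. -/
def IsDominatingSet {V : Type*} (G : SimpleGraph V) (S : Set V) : Prop :=
  ∀ v, v ∈ S ∨ ∃ w ∈ S, G.Adj v w

/-- `S` is a locating-dominating set of `G`: it is dominating, and distinct vertices outside `S`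
have different neighbourhoods in `S`. -/
def IsLocatingDominatingSet {V : Type*} (G : SimpleGraph V) (S : Set V) : Prop :=
  IsDominatingSet G S ∧
    ∀ u v, u ∉ S → v ∉ S → u ≠ v → G.neighborSet u ∩ S ≠ G.neighborSet v ∩ S

/-- The problem Locating-Dominating Set: is there a locating-dominating set of size `k`? -/
def LocatingDominatingSet {V : Type*} (G : SimpleGraph V) (k : ℕ) : Prop :=
  ∃ S : Finset V, S.card = k ∧ IsLocatingDominatingSet G (S : Set V)

open Classical in
/-- The instance `(G, k)` as machine input: `n`, `k`, and the adjacency matrix row by row. -/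
noncomputable def ldsInput {n : ℕ} (G : SimpleGraph (Fin n)) (k : ℕ) : List ℕ :=
  n :: k :: List.ofFn fun p : Fin (n * n) => if G.Adj p.divNat p.modNat then 1 else 0

/-! ## Test covers -/

/-- The problem Test Cover for the items `U` and the tests `F j`, `j ∈ J`: are there at most `k`
tests such that every two distinct items are separated by one of them, that is, one of these tests
contains exactly one of the two items? -/
def TestCover {U J : Type*} (F : J → Finset U) (k : ℕ) : Prop :=
  ∃ T : Finset J, T.card ≤ k ∧ ∀ x y : U, x ≠ y → ∃ j ∈ T, Xor (x ∈ F j) (y ∈ F j)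

/-- The instance `(U, F, k)` with `u` items and `m` tests as machine input: `u`, `m`, `k`, and the
incidence matrix row by row, one row for each test. -/
def testCoverInput {u m : ℕ} (F : Fin m → Finset (Fin u)) (k : ℕ) : List ℕ :=
  u :: m :: k :: List.ofFn fun p : Fin (m * u) => if p.modNat ∈ F p.divNat then 1 else 0

/-! Both algorithms are dynamic programs over labellings: a partition of a set of `r` elements is
recorded by a label at most `r` for each element, so a partition is a number with `r` digits and
there are `2^{O(r log r)}` codes.

Test Cover. A state is a number of chosen tests and a labelling of the items. Choosing one more test
may separate further pairs of items, and a labelling is allowed if every pair it separates was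
separated before or is separated by the new test. Hence a reachable labelling never claims more than
some set of tests of that size achieves, while every set of tests yields the exact labelling by
"contained in the same chosen tests". This is `testCover_iff_of_reachable`.

Locating-Dominating Set. The vertices touched by a greedy maximal matching form a vertex cover `C`
of size at most `2 vc` (`GreedyMatching.isCover`, `GreedyMatching.count_le`), so `vc` itself is
never needed by the program. Guess which vertices of `C` lie in the solution `S`, and which of the
others must have a neighbour in `S` outside `C`. The vertices outside `C` are independent, so what
they see of `S` lies in `S ∩ C`. Group them by this neighbourhood: at most one vertex of each class
can be left out of `S`. Whether a vertex may be left out depends on the guess alone, and what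
remains to be known is how the part of `S` outside `C` dominates and separates the vertices of `C`.
This is again a labelling, now of `C`, with label `0` for "no neighbour so far". The classes are
handled one at a time, each choosing its omitted vertex or none. Soundness is
`CoveredGraph.Realizes.step` and `CoveredGraph.Realizes.exists_locDom`, completeness
`CoveredGraph.LocDom.step` and `CoveredGraph.LocDom.accepts`; `exists_locDom_iff_of_reachable`
combines them.

Machine model. Both tables are described by fixed terms with bounded sums, from which quantifiers,
products and division are derived. Such a term compiles to nested loops whose time is polynomial in
the common bound `lim` (`Term.compile_ends`, `Term.exists_time_le`), and a table filled in
increasing order realizes a recursion on smaller states (`Cmd.run_fill`). The time is thus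
polynomial in the number of states, which is at most a constant times a power of `v ^ v` times a
power of the input size, for `v = vc` or `v = |U|`. -/

/-! ## Terms of bounded arithmetic, compiled to machine programs -/

namespace RAM

/-- Terms of bounded arithmetic. All sums have the same number of summands, the value of `lim`. -/
inductive Term where
  | const (c : ℕ)
  | var (x : ℕ)
  | lim
  | add (a b : Term)
  | sub (a b : Term)
  | get (A : ℕ) (i : Term)
  | ite (c a b : Term)
  | sum (x : ℕ) (e : Term)

/-- A memory for terms: the bound of the sums, the variables and the arrays. -/
@[ext] structure Mem where
  lim : ℕ
  env : ℕ → ℕ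
  arr : ℕ → ℕ → ℕ

def Mem.bind (m : Mem) (x v : ℕ) : Mem where
  lim := m.lim
  env := Function.update m.env x v
  arr := m.arr

@[simp] theorem Mem.bind_lim (m : Mem) (x v : ℕ) : (m.bind x v).lim = m.lim := rfl
@[simp] theorem Mem.bind_arr (m : Mem) (x v : ℕ) : (m.bind x v).arr = m.arr := rfl
@[simp] theorem Mem.bind_env (m : Mem) (x v y : ℕ) :
    (m.bind x v).env y = if y = x then v else m.env y := by
  simp [Mem.bind, Function.update_apply]

def Term.eval : Term → Mem → ℕ
  | const c, _ => c
  | var x, m => m.env x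
  | lim, m => m.lim
  | add a b, m => a.eval m + b.eval m
  | sub a b, m => a.eval m - b.eval m
  | get A i, m => m.arr A (i.eval m)
  | ite c a b, m => if c.eval m = 0 then b.eval m else a.eval m
  | sum x e, m => ∑ i ∈ Finset.range m.lim, e.eval (m.bind x i)

/-- The memory of terms inside a machine state: the bound is the variable `0`, the variables are the
other even ones. -/
def State.mem (s : State) : Mem where
  lim := s.var 0
  env x := s.var (2 * x + 2)
  arr := s.arr

/-- A program for the value of a term, which ends up in the variable `2 * d + 1`. -/
def Term.compile : Term → ℕ → Prog
  | const c, d => .assign (2 * d + 1) (.const c)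
  | var x, d => .assign (2 * d + 1) (.var (2 * x + 2))
  | lim, d => .assign (2 * d + 1) (.var 0)
  | add a b, d => .seq (a.compile d) (.seq (b.compile (d + 1))
      (.assign (2 * d + 1) (.add (.var (2 * d + 1)) (.var (2 * d + 3)))))
  | sub a b, d => .seq (a.compile d) (.seq (b.compile (d + 1))
      (.assign (2 * d + 1) (.sub (.var (2 * d + 1)) (.var (2 * d + 3)))))
  | get A i, d => .seq (i.compile d) (.assign (2 * d + 1) (.get A (.var (2 * d + 1))))
  | ite c a b, d => .seq (c.compile d) (.ite (.var (2 * d + 1)) (a.compile d) (b.compile d))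
  -- The register `2 * d + 1` accumulates, `2 * d + 3` holds the bound, and `2 * d + 5` saves the
  -- outer value of the loop variable, which is restored at the end. The body therefore works from
  -- depth `d + 3`.
  | sum x e, d =>
      .seq (.assign (2 * d + 1) (.const 0)) <|
      .seq (.assign (2 * d + 3) (.var 0)) <|
      .seq (.assign (2 * d + 5) (.var (2 * x + 2))) <|
      .seq (.assign (2 * x + 2) (.const 0)) <|
      .seq (.while (.sub (.var (2 * d + 3)) (.var (2 * x + 2)))
        (.seq (e.compile (d + 3))
          (.seq (.assign (2 * d + 1) (.add (.var (2 * d + 1)) (.var (2 * (d + 3) + 1))))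
            (.assign (2 * x + 2) (.add (.var (2 * x + 2)) (.const 1)))))) <|
      .assign (2 * x + 2) (.var (2 * d + 5))

/-- The argument `M` stands for the bound of the sums. Each level of nested sums costs one factor
`M`, so that a fixed term has polynomial time. -/
def Term.time : Term → ℕ → ℕ
  | const _, _ => 2
  | var _, _ => 2
  | lim, _ => 2
  | add a b, M => a.time M + (b.time M + 4)
  | sub a b, M => a.time M + (b.time M + 4)
  | get _ i, M => i.time M + 3
  | ite c a b, M => c.time M + (a.time M + b.time M + 2)
  | sum _ e, M => M * (e.time M + 12) + 14

/-! ### Execution within a time bound, and correctness of the compiler -/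

/-- The program terminates within `T` steps in a state with the property `Q`. -/
def Ends (p : Prog) (s : State) (T : ℕ) (Q : State → Prop) : Prop :=
  ∃ t s', Exec p s t s' ∧ t ≤ T ∧ Q s'

theorem Ends.mono {p : Prog} {s : State} {T T' : ℕ} {Q Q' : State → Prop}
    (h : Ends p s T Q) (hT : T ≤ T') (hQ : ∀ s', Q s' → Q' s') : Ends p s T' Q' := by
  obtain ⟨t, s', h1, h2, h3⟩ := h
  exact ⟨t, s', h1, h2.trans hT, hQ _ h3⟩

theorem Ends.seq {p q : Prog} {s : State} {T T' : ℕ} {Q : State → Prop}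
    (h : Ends p s T fun s' => Ends q s' T' Q) : Ends (.seq p q) s (T + T') Q := by
  obtain ⟨t, s', h1, h2, t', s'', h3, h4, h5⟩ := h
  exact ⟨_, s'', .seq h1 h3, by omega, h5⟩

theorem Ends.assign {x : ℕ} {e : Expr} {s : State} {Q : State → Prop}
    (h : Q (s.setVar x (e.eval s))) : Ends (.assign x e) s (e.cost + 1) Q :=
  ⟨_, _, .assign x e s, le_rfl, h⟩

theorem Ends.store {A : ℕ} {i e : Expr} {s : State} {Q : State → Prop}
    (h : Q (s.setArr A (i.eval s) (e.eval s))) : Ends (.store A i e) s (i.cost + e.cost + 1) Q :=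
  ⟨_, _, .store A i e s, le_rfl, h⟩

theorem Ends.ite {e : Expr} {p q : Prog} {s : State} {T T' : ℕ} {Q : State → Prop}
    (hp : e.eval s ≠ 0 → Ends p s T Q) (hq : e.eval s = 0 → Ends q s T' Q) :
    Ends (.ite e p q) s (T + T' + (e.cost + 1)) Q := by
  by_cases h : e.eval s = 0
  · obtain ⟨t, s', h1, h2, h3⟩ := hq h
    exact ⟨_, s', .iteFalse h h1, by omega, h3⟩
  · obtain ⟨t, s', h1, h2, h3⟩ := hp h
    exact ⟨_, s', .iteTrue h h1, by omega, h3⟩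

theorem Ends.loop {e : Expr} {p : Prog} {T : ℕ} (n : ℕ) (I : ℕ → State → Prop)
    (hstep : ∀ i < n, ∀ s, I i s → e.eval s ≠ 0 ∧ Ends p s T (I (i + 1)))
    (hend : ∀ s, I n s → e.eval s = 0) {s : State} (h0 : I 0 s) :
    Ends (.while e p) s (n * (e.cost + 1 + T) + (e.cost + 1)) (I n) := by
  suffices H : ∀ k i, i + k = n → ∀ s, I i s →
      Ends (.while e p) s (k * (e.cost + 1 + T) + (e.cost + 1)) (I n) from
    H n 0 (by simp) s h0
  intro k
  induction k with
  | zero =>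
    rintro i rfl s hs
    exact ⟨_, s, .whileFalse (hend s hs), by omega, hs⟩
  | succ k ih =>
    intro i hi s hs
    obtain ⟨h1, t, s', h2, h3, h4⟩ := hstep i (by omega) s hs
    obtain ⟨t', s'', h5, h6, h7⟩ := ih (i + 1) (by omega) s' h4
    refine ⟨_, s'', .whileTrue h1 h2 h5, ?_, h7⟩
    rw [Nat.add_mul]
    omega

@[simp] theorem State.setVar_var (s : State) (x v y : ℕ) :
    (s.setVar x v).var y = if y = x then v else s.var y := by
  simp [State.setVar, Function.update_apply]

@[simp] theorem State.setVar_arr (s : State) (x v : ℕ) : (s.setVar x v).arr = s.arr := rfl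

/-- The states agree except on the odd variables from `2 * d + 1` on. -/
def State.AgreeBelow (d : ℕ) (s s' : State) : Prop :=
  s'.arr = s.arr ∧ ∀ y, (y % 2 = 0 ∨ y < 2 * d + 1) → s'.var y = s.var y

theorem State.AgreeBelow.mem {d : ℕ} {s s' : State} (h : s.AgreeBelow d s') : s'.mem = s.mem := by
  ext1
  · exact h.2 0 (by simp)
  · funext x
    exact h.2 (2 * x + 2) (by omega)
  · exact h.1

theorem Term.compile_ends (e : Term) (d : ℕ) (s : State) :
    Ends (e.compile d) s (e.time (s.var 0)) fun s' =>
      s.AgreeBelow d s' ∧ s'.var (2 * d + 1) = e.eval s.mem := by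
  have hset : ∀ (d : ℕ) (s s' : State) (v : ℕ), s.AgreeBelow d s' →
      s.AgreeBelow d (s'.setVar (2 * d + 1) v) := by
    rintro d s s' v ⟨h1, h2⟩
    refine ⟨h1, fun y hy => ?_⟩
    rw [State.setVar_var, if_neg (by omega), h2 y hy]
  have hrefl : ∀ d (s : State), s.AgreeBelow d s := fun d s => ⟨rfl, fun _ _ => rfl⟩
  have hbin : ∀ (a b : Term) (c : Expr → Expr → Expr) (f : ℕ → ℕ → ℕ) (d : ℕ) (s : State),
      (∀ u v, (c u v).cost = u.cost + v.cost + 1) →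
      (∀ u v s, (c u v).eval s = f (u.eval s) (v.eval s)) →
      (∀ d s, Ends (a.compile d) s (a.time (s.var 0)) fun s' =>
        s.AgreeBelow d s' ∧ s'.var (2 * d + 1) = a.eval s.mem) →
      (∀ d s, Ends (b.compile d) s (b.time (s.var 0)) fun s' =>
        s.AgreeBelow d s' ∧ s'.var (2 * d + 1) = b.eval s.mem) →
      Ends (.seq (a.compile d) (.seq (b.compile (d + 1))
        (.assign (2 * d + 1) (c (.var (2 * d + 1)) (.var (2 * d + 3))))))
        s (a.time (s.var 0) + (b.time (s.var 0) + 4)) fun s' =>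
      s.AgreeBelow d s' ∧ s'.var (2 * d + 1) = f (a.eval s.mem) (b.eval s.mem) := by
    intro a b c f d s hc hf ha hb
    refine .seq ((ha d s).mono le_rfl ?_)
    rintro s₁ ⟨h1, h2⟩
    refine .seq ((hb (d + 1) s₁).mono ?_ ?_)
    · rw [h1.2 0 (by simp)]
    rintro s₂ ⟨h3, h4⟩
    have := Ends.assign (x := 2 * d + 1) (e := c (.var (2 * d + 1)) (.var (2 * d + 3))) (s := s₂)
      (Q := fun s' => s.AgreeBelow d s' ∧ s'.var (2 * d + 1) = f (a.eval s.mem) (b.eval s.mem))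
    refine (this ⟨hset _ _ _ _ ⟨h3.1.trans h1.1, fun y hy => ?_⟩, ?_⟩).mono ?_ fun _ h => h
    · rw [h3.2 y (by omega), h1.2 y hy]
    · rw [State.setVar_var, if_pos rfl, hf]
      simp only [Expr.eval]
      rw [h3.2 _ (by omega), h2, show 2 * d + 3 = 2 * (d + 1) + 1 by ring, h4, h1.mem]
    · simp [hc, Expr.cost]
  induction e generalizing d s with
  | const c => exact .assign ⟨hset _ _ _ _ (hrefl _ _), by simp [Expr.eval, Term.eval]⟩
  | var x => exact .assign ⟨hset _ _ _ _ (hrefl _ _), by simp [Expr.eval, State.mem, Term.eval]⟩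
  | lim => exact .assign ⟨hset _ _ _ _ (hrefl _ _), by simp [Expr.eval, State.mem, Term.eval]⟩
  | add a b iha ihb =>
    exact hbin a b .add (· + ·) d s (fun _ _ => rfl) (fun _ _ _ => rfl) iha ihb
  | sub a b iha ihb =>
    exact hbin a b .sub (· - ·) d s (fun _ _ => rfl) (fun _ _ _ => rfl) iha ihb
  | get A i ih =>
    refine .seq ((ih d s).mono le_rfl ?_)
    rintro s₁ ⟨h1, h2⟩
    exact .assign ⟨hset _ _ _ _ h1, by simp [Expr.eval, State.mem, h2, h1.1, Term.eval]⟩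
  | ite c a b ihc iha ihb =>
    refine .seq ((ihc d s).mono le_rfl ?_)
    rintro s₁ ⟨h1, h2⟩
    have h0 := h1.2 0 (by simp)
    rw [← h0]
    have htr : ∀ s', s₁.AgreeBelow d s' → s.AgreeBelow d s' := fun s' h3 =>
      ⟨h3.1.trans h1.1, fun y hy => (h3.2 y hy).trans (h1.2 y hy)⟩
    refine .ite (fun h => (iha d s₁).mono le_rfl ?_) (fun h => (ihb d s₁).mono le_rfl ?_)
    · rintro s' ⟨h3, h4⟩
      simp only [Expr.eval, h2] at h
      exact ⟨htr _ h3, by simp [h4, h1.mem, h, Term.eval]⟩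
    · rintro s' ⟨h3, h4⟩
      simp only [Expr.eval, h2] at h
      exact ⟨htr _ h3, by simp [h4, h1.mem, h, Term.eval]⟩
  | sum x e ih =>
    -- The time is regrouped into the shape that `Ends.seq` and `Ends.loop` produce: four
    -- assignments, then the loop with cost `4` for each test of its condition, then the restoring
    -- assignment.
    have hT : (Term.sum x e).time (s.var 0) = 2 + (2 + (2 + (2 +
        ((s.var 0) * (4 + (e.time (s.var 0) + (4 + 4))) + 4 + 2)))) := by
      simp only [Term.time]; ring
    rw [hT]
    refine .seq (.assign (.seq (.assign (.seq (.assign (.seq (.assign (.seq ?_))))))))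
    refine (Ends.loop (s.var 0) (fun i s' => s'.arr = s.arr ∧
      s'.var (2 * d + 1) = ∑ k ∈ Finset.range i, e.eval (s.mem.bind x k) ∧
      s'.var (2 * d + 3) = s.var 0 ∧ s'.var (2 * d + 5) = s.var (2 * x + 2) ∧
      s'.var (2 * x + 2) = i ∧
      ∀ y, (y % 2 = 0 ∨ y < 2 * d + 1) → y ≠ 2 * x + 2 → s'.var y = s.var y)
      ?_ ?_ ?_).mono le_rfl ?_
    · rintro i hi s₁ ⟨h1, h2, h3, h4, h5, h6⟩
      refine ⟨by simp only [Expr.eval]; omega, ?_⟩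
      have hm : s₁.mem = s.mem.bind x i := by
        ext1
        · exact h6 0 (by simp) (by omega)
        · funext y
          by_cases hy : y = x
          · subst hy; simp [State.mem, h5]
          · simpa [State.mem, hy] using h6 (2 * y + 2) (by omega) (by omega)
        · exact h1
      refine .seq ((ih (d + 3) s₁).mono ?_ ?_)
      · rw [h6 0 (by simp) (by omega)]
      rintro s₂ ⟨h7, h8⟩
      refine .seq (.assign (.assign ?_))
      simp only [State.setVar_var, State.setVar_arr, Expr.eval]
      refine ⟨h7.1.trans h1, ?_, ?_, ?_, ?_, ?_⟩
      · rw [if_neg (by omega), if_pos trivial, h7.2 _ (by omega), h8, h2, hm, Finset.sum_range_succ]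
      · rw [if_neg (by omega), if_neg (by omega), h7.2 _ (by omega), h3]
      · rw [if_neg (by omega), if_neg (by omega), h7.2 _ (by omega), h4]
      · rw [if_pos trivial, if_neg (by omega), h7.2 _ (by omega), h5]
      · intro y hy hyx
        rw [if_neg (by omega), if_neg (by omega), h7.2 _ (by omega), h6 y hy hyx]
    · rintro s₁ ⟨h1, h2, h3, h4, h5, h6⟩
      simp only [Expr.eval]; omega
    · simp only [State.setVar_var, State.setVar_arr, Expr.eval]
      refine ⟨trivial, ?_, ?_, ?_, ?_, ?_⟩
      · rw [if_neg (by omega), if_neg (by omega), if_neg (by omega), if_pos trivial]; simp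
      · rw [if_neg (by omega), if_neg (by omega), if_pos trivial]; simp
      · rw [if_neg (by omega), if_pos trivial, if_neg (by omega), if_neg (by omega)]
      · simp
      · intro y hy hyx
        rw [if_neg (by omega), if_neg (by omega), if_neg (by omega), if_neg (by omega)]
    · rintro s₁ ⟨h1, h2, h3, h4, h5, h6⟩
      refine .assign ⟨⟨h1, fun y hy => ?_⟩, ?_⟩
      · simp only [State.setVar_var, Expr.eval]
        split_ifs with h
        · rw [h4, h]
        · exact h6 y hy h
      · simp only [State.setVar_var, Expr.eval, Term.eval]
        rw [if_neg (by omega), h2]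
        rfl

/-! ### Polynomial time bounds -/

theorem exists_poly_add {f g : ℕ → ℕ} (hf : ∃ K, ∀ M, f M ≤ K * (M + 1) ^ K)
    (hg : ∃ K, ∀ M, g M ≤ K * (M + 1) ^ K) : ∃ K, ∀ M, f M + g M ≤ K * (M + 1) ^ K := by
  obtain ⟨K, hK⟩ := hf
  obtain ⟨K', hK'⟩ := hg
  refine ⟨K + K', fun M => ?_⟩
  calc f M + g M ≤ K * (M + 1) ^ K + K' * (M + 1) ^ K' := add_le_add (hK M) (hK' M)
    _ ≤ K * (M + 1) ^ (K + K') + K' * (M + 1) ^ (K + K') := by gcongr <;> omega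
    _ = _ := by ring

theorem exists_poly_const (c : ℕ) : ∃ K, ∀ M : ℕ, c ≤ K * (M + 1) ^ K :=
  ⟨c, fun M => Nat.le_mul_of_pos_right _ (by positivity)⟩

theorem exists_poly_mul_self {f : ℕ → ℕ} (hf : ∃ K, ∀ M, f M ≤ K * (M + 1) ^ K) :
    ∃ K, ∀ M, M * f M ≤ K * (M + 1) ^ K := by
  obtain ⟨K, hK⟩ := hf
  refine ⟨K + 1, fun M => ?_⟩
  calc M * f M ≤ (M + 1) * (K * (M + 1) ^ K) := Nat.mul_le_mul (by omega) (hK M)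
    _ = K * (M + 1) ^ (K + 1) := by ring
    _ ≤ _ := by gcongr; omega

theorem Term.exists_time_le (e : Term) : ∃ K, ∀ M, e.time M ≤ K * (M + 1) ^ K := by
  induction e with
  | const | var | lim => exact exists_poly_const 2
  | add a b iha ihb | sub a b iha ihb =>
    exact exists_poly_add iha (exists_poly_add ihb (exists_poly_const 4))
  | get A i ih => exact exists_poly_add ih (exists_poly_const 3)
  | ite c a b ihc iha ihb =>
    exact exists_poly_add ihc (exists_poly_add (exists_poly_add iha ihb) (exists_poly_const 2))
  | sum x e ih =>
    exact exists_poly_add (exists_poly_mul_self (exists_poly_add ih (exists_poly_const 12)))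
      (exists_poly_const 14)

/-! ### Straight-line programs over terms -/

inductive Cmd where
  /-- the bound of the sums becomes `e` -/
  | setLim (e : Term)
  /-- `A[x] := e` for `x` from `0` to the bound of the sums -/
  | fill (A x : ℕ) (e : Term)

def Mem.store (m : Mem) (A i v : ℕ) : Mem where
  lim := m.lim
  env := m.env
  arr := Function.update m.arr A (Function.update (m.arr A) i v)

/-- The entries are written in place, one after another, so that `e` can read the entries computed
before. -/
def Mem.fillTo (m : Mem) (A x : ℕ) (e : Term) : ℕ → Mem
  | 0 => m.bind x 0
  | i + 1 => ((m.fillTo A x e i).store A i (e.eval (m.fillTo A x e i))).bind x (i + 1)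

def Cmd.run : Cmd → Mem → Mem
  | setLim e, m => { m with lim := e.eval m }
  | fill A x e, m => m.fillTo A x e m.lim

def Cmd.compile : Cmd → Prog
  | setLim e => .seq (e.compile 0) (.assign 0 (.var 1))
  | fill A x e => .seq (.assign 1 (.var 0)) <| .seq (.assign (2 * x + 2) (.const 0)) <|
      .while (.sub (.var 1) (.var (2 * x + 2)))
        (.seq (e.compile 1) (.seq (.store A (.var (2 * x + 2)) (.var 3))
          (.assign (2 * x + 2) (.add (.var (2 * x + 2)) (.const 1)))))

def Cmd.time : Cmd → ℕ → ℕ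
  | setLim e, M => e.time M + 2
  | fill _ _ e, M => M * (e.time M + 11) + 8

theorem Mem.fillTo_lim (m : Mem) (A x : ℕ) (e : Term) (i : ℕ) :
    (m.fillTo A x e i).lim = m.lim := by
  induction i with
  | zero => rfl
  | succ i ih => exact ih

theorem Cmd.compile_ends (c : Cmd) (s : State) :
    Ends c.compile s (c.time (s.var 0)) fun s' => s'.mem = c.run s.mem := by
  cases c with
  | setLim e =>
    refine .seq ((e.compile_ends 0 s).mono le_rfl ?_)
    rintro s₁ ⟨h1, h2⟩
    refine .assign ?_
    rw [← h1.mem] at h2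
    ext1
    · simp only [Expr.eval, State.mem, State.setVar_var]
      exact h2.trans (by rw [h1.mem]; rfl)
    · funext y
      simpa [State.mem, Cmd.run] using h1.2 (2 * y + 2) (by omega)
    · exact h1.1
  | fill A x e =>
    have hT : (Cmd.fill A x e).time (s.var 0) = 2 + (2 +
        ((s.var 0) * (4 + (e.time (s.var 0) + (3 + 4))) + 4)) := by
      simp only [Cmd.time]; ring
    rw [hT]
    refine .seq (.assign (.seq (.assign ?_)))
    refine (Ends.loop (s.var 0) (fun i s' => s'.mem = s.mem.fillTo A x e i ∧
      s'.var (2 * x + 2) = i ∧ s'.var 1 = s.var 0) ?_ ?_ ?_).mono le_rfl fun _ h => h.1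
    · rintro i hi s₁ ⟨h1, h2, h3⟩
      refine ⟨by simp only [Expr.eval]; omega, ?_⟩
      refine .seq ((e.compile_ends 1 s₁).mono ?_ ?_)
      · have : s₁.mem.lim = s.mem.lim := by rw [h1, Mem.fillTo_lim]
        rw [show s₁.var 0 = s.var 0 from this]
      rintro s₂ ⟨h4, h5⟩
      refine .seq (.store (.assign ⟨?_, ?_, ?_⟩))
      · rw [Mem.fillTo, ← h1, ← h5, ← h4.mem]
        have hx := h4.2 (2 * x + 2) (by omega)
        ext1
        · simp [State.mem, State.setArr, Mem.store]
        · funext y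
          simp [State.mem, State.setArr, Mem.store, Expr.eval, hx, h2]
        · simp [State.mem, State.setArr, Mem.store, Expr.eval, hx, h2]
      · simp [State.setArr, Expr.eval, h4.2 (2 * x + 2) (by omega), h2]
      · simp [State.setArr, h4.2 1 (by omega), h3]
    · rintro s₁ ⟨h1, h2, h3⟩
      simp only [Expr.eval]; omega
    · refine ⟨?_, by simp [Expr.eval], by simp [Expr.eval]⟩
      ext1
      · simp [State.mem, Mem.fillTo]
      · funext y
        simp [State.mem, Mem.fillTo, Expr.eval]
      · rfl

theorem Cmd.exists_time_le (c : Cmd) : ∃ K, ∀ M, c.time M ≤ K * (M + 1) ^ K := by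
  cases c with
  | setLim e => exact exists_poly_add e.exists_time_le (exists_poly_const 2)
  | fill A x e =>
    exact exists_poly_add (exists_poly_mul_self
      (exists_poly_add e.exists_time_le (exists_poly_const 11))) (exists_poly_const 8)

def Cmd.runAll (l : List Cmd) (m : Mem) : Mem := l.foldl (fun m c => c.run m) m

/-- The bound of the sums stays below `M` during the run. -/
def Cmd.LimLe (M : ℕ) : List Cmd → Mem → Prop
  | [], m => m.lim ≤ M
  | c :: l, m => m.lim ≤ M ∧ Cmd.LimLe M l (c.run m)

/-- The program that runs the commands and reports the value of `e`. -/
def Cmd.toProg : List Cmd → Term → Prog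
  | [], e => .seq (e.compile 0) (.assign 0 (.var 1))
  | c :: l, e => .seq c.compile (Cmd.toProg l e)

/-- The exponent `K` depends on the commands only: there is a fixed number of them, and each is
polynomial in the bound in force, which is at most `M`. -/
theorem Cmd.exists_toProg_ends (l : List Cmd) (e : Term) : ∃ K, ∀ (M : ℕ) (s : State),
    Cmd.LimLe M l s.mem → Ends (Cmd.toProg l e) s (K * (M + 1) ^ K) fun s' =>
      s'.var 0 = e.eval (Cmd.runAll l s.mem) := by
  induction l with
  | nil =>
    obtain ⟨K, hK⟩ := exists_poly_add e.exists_time_le (exists_poly_const 2)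
    refine ⟨K, fun M s hM => ?_⟩
    have : s.var 0 ≤ M := hM
    refine Ends.mono (T := e.time (s.var 0) + 2) (.seq ((e.compile_ends 0 s).mono le_rfl ?_))
      ((hK _).trans (by gcongr)) fun _ h => h
    rintro s₁ ⟨h1, h2⟩
    exact .assign (by simpa [Expr.eval, Cmd.runAll] using h2)
  | cons c l ih =>
    obtain ⟨K', hK'⟩ := ih
    obtain ⟨K₁, hK₁⟩ := c.exists_time_le
    obtain ⟨K, hK⟩ := exists_poly_add ⟨K₁, fun M => le_refl (K₁ * (M + 1) ^ K₁)⟩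
      ⟨K', fun M => le_refl (K' * (M + 1) ^ K')⟩
    refine ⟨K, fun M s hM => ?_⟩
    have h0 : s.var 0 ≤ M := hM.1
    refine Ends.mono (T := c.time (s.var 0) + K' * (M + 1) ^ K')
      (.seq ((c.compile_ends s).mono le_rfl ?_)) ((hK M).trans' ?_) fun _ h => h
    · intro s₁ h
      rw [show Cmd.runAll (c :: l) s.mem = Cmd.runAll l s₁.mem by rw [h]; rfl]
      exact hK' M s₁ (h ▸ hM.2)
    · gcongr
      exact (hK₁ _).trans (by gcongr)

end RAM

namespace RAM

/-! ### Derived terms -/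

/-- All variables of the term are below this number. -/
def Term.varBound : Term → ℕ
  | const _ => 0
  | var x => x + 1
  | lim => 0
  | add a b => max a.varBound b.varBound
  | sub a b => max a.varBound b.varBound
  | get _ i => i.varBound
  | ite c a b => max c.varBound (max a.varBound b.varBound)
  | sum x e => max (x + 1) e.varBound

theorem Mem.bind_comm (m : Mem) {x y : ℕ} (h : x ≠ y) (v w : ℕ) :
    (m.bind x v).bind y w = (m.bind y w).bind x v := by
  ext1
  · rfl
  · exact Function.update_comm h.symm _ _ _ |>.symm
  · rfl

/-- A variable from `varBound` on occurs neither free nor bound. This makes it a fresh loop variable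
for `mul` and `div`. -/
theorem Term.eval_bind {e : Term} {x : ℕ} (h : e.varBound ≤ x) (m : Mem) (v : ℕ) :
    e.eval (m.bind x v) = e.eval m := by
  induction e generalizing m with
  | const | lim => rfl
  | var y => simp only [varBound] at h; simp [eval]; omega
  | add a b iha ihb | sub a b iha ihb =>
    simp only [varBound] at h; simp [eval, iha (by omega), ihb (by omega)]
  | get A i ih => simp only [varBound] at h; simp [eval, ih h]
  | ite c a b ihc iha ihb =>
    simp only [varBound] at h; simp [eval, ihc (by omega), iha (by omega), ihb (by omega)]
  | sum y e ih =>
    simp only [varBound] at h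
    simp only [eval, Mem.bind_lim]
    refine Finset.sum_congr rfl fun i _ => ?_
    rw [Mem.bind_comm _ (by omega), ih (by omega)]

namespace Term

def Holds (e : Term) (m : Mem) : Prop := e.eval m ≠ 0

instance (e : Term) (m : Mem) : Decidable (e.Holds m) := inferInstanceAs (Decidable (_ ≠ _))

def and (a b : Term) : Term := ite a b (const 0)
def or (a b : Term) : Term := ite a (const 1) b
def not (a : Term) : Term := ite a (const 0) (const 1)
def imp (a b : Term) : Term := ite a b (const 1)
def lt (a b : Term) : Term := sub b a
def eq (a b : Term) : Term := ite (sub a b) (const 0) (ite (sub b a) (const 0) (const 1))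
def ex (x : ℕ) (a : Term) : Term := sum x a
def all (x : ℕ) (a : Term) : Term := not (sum x (not a))
def count (x : ℕ) (a : Term) : Term := sum x (ite a (const 1) (const 0))
-- A sum that adds `b` once for each index below `a`. Only `lim` many indices are available, whence
-- the truncation of the first factor in `eval_mul`.
def mul (a b : Term) : Term :=
  sum (max a.varBound b.varBound)
    (ite (lt (var (max a.varBound b.varBound)) a) b (const 0))
-- The quotient counts the `i` with `(i + 1) * b ≤ a`. The separate case `b = 0` reproduces the
-- convention of `Nat.div`.
def div (a b : Term) : Term :=
  ite b (count (max a.varBound b.varBound) (lt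
    (mul (add (var (max a.varBound b.varBound)) (const 1)) b) (add a (const 1)))) (const 0)
def mod (a b : Term) : Term := sub a (mul (div a b) b)

variable {a b c : Term} {m : Mem} {x A : ℕ}

@[simp] theorem eval_const : (const x).eval m = x := rfl
@[simp] theorem eval_var : (var x).eval m = m.env x := rfl
@[simp] theorem eval_lim : lim.eval m = m.lim := rfl
@[simp] theorem eval_add : (add a b).eval m = a.eval m + b.eval m := rfl
@[simp] theorem eval_sub : (sub a b).eval m = a.eval m - b.eval m := rfl
@[simp] theorem eval_get : (get A a).eval m = m.arr A (a.eval m) := rfl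
@[simp] theorem eval_sum :
    (sum x a).eval m = ∑ i ∈ Finset.range m.lim, a.eval (m.bind x i) := rfl

@[simp] theorem eval_ite : (ite c a b).eval m = if c.Holds m then a.eval m else b.eval m := by
  by_cases h : c.eval m = 0 <;> simp [Holds, h, eval]

theorem holds_iff : a.Holds m ↔ a.eval m ≠ 0 := Iff.rfl

@[simp] theorem holds_get : (get A a).Holds m ↔ m.arr A (a.eval m) ≠ 0 := Iff.rfl

@[simp] theorem holds_and : (and a b).Holds m ↔ a.Holds m ∧ b.Holds m := by
  by_cases h : a.eval m = 0 <;> simp [Holds, and, eval, h]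

@[simp] theorem holds_or : (or a b).Holds m ↔ a.Holds m ∨ b.Holds m := by
  by_cases h : a.eval m = 0 <;> simp [Holds, or, eval, h]

@[simp] theorem holds_not : (not a).Holds m ↔ ¬ a.Holds m := by
  by_cases h : a.eval m = 0 <;> simp [Holds, not, eval, h]

@[simp] theorem holds_imp : (imp a b).Holds m ↔ (a.Holds m → b.Holds m) := by
  by_cases h : a.eval m = 0 <;> simp [Holds, imp, eval, h]

@[simp] theorem holds_lt : (lt a b).Holds m ↔ a.eval m < b.eval m := by
  simp [Holds, lt, Nat.sub_eq_zero_iff_le]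

@[simp] theorem holds_eq : (eq a b).Holds m ↔ a.eval m = b.eval m := by
  have h1 : (sub a b).Holds m ↔ b.eval m < a.eval m := holds_lt
  have h2 : (sub b a).Holds m ↔ a.eval m < b.eval m := holds_lt
  rw [Holds, eq, eval_ite, eval_ite]
  split_ifs with h3 h4 <;> simp only [h1, h2] at * <;> simp <;> omega

@[simp] theorem holds_ex : (ex x a).Holds m ↔ ∃ i < m.lim, a.Holds (m.bind x i) := by
  simp [Holds, ex]

@[simp] theorem holds_all : (all x a).Holds m ↔ ∀ i < m.lim, a.Holds (m.bind x i) := by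
  have := holds_ex (x := x) (a := not a) (m := m)
  rw [all, holds_not, show (sum x (not a)).Holds m ↔ _ from this]
  simp

@[simp] theorem eval_count : (count x a).eval m =
    ((Finset.range m.lim).filter fun i => a.Holds (m.bind x i)).card := by
  rw [Finset.card_filter]; simp only [count, eval_sum, eval_ite, eval_const]

@[simp] theorem eval_mul : (mul a b).eval m = min (a.eval m) m.lim * b.eval m := by
  simp only [mul, eval_sum, eval_ite, eval_var, eval_const, holds_lt,
    eval_bind (le_max_left a.varBound b.varBound),
    eval_bind (le_max_right a.varBound b.varBound), Mem.bind_env, if_true]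
  rw [← Finset.sum_filter, Finset.sum_const, smul_eq_mul]
  congr 1
  rw [show (Finset.range m.lim).filter (fun i => i < a.eval m) =
    Finset.range (min (a.eval m) m.lim) by ext; simp; omega, Finset.card_range]

@[simp] theorem eval_div : (div a b).eval m = min (a.eval m / b.eval m) m.lim := by
  simp only [div, eval_add, eval_ite, eval_var, eval_const, eval_count, holds_lt, eval_mul,
    eval_bind (le_max_left a.varBound b.varBound),
    eval_bind (le_max_right a.varBound b.varBound), Mem.bind_env, if_true, Mem.bind_lim]
  by_cases h : b.eval m = 0
  · simp [Holds, h]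
  · rw [if_pos (show b.Holds m from h),
      show (Finset.range m.lim).filter (fun i => min (i + 1) m.lim * b.eval m <
      a.eval m + 1) = Finset.range (min (a.eval m / b.eval m) m.lim) from ?_, Finset.card_range]
    ext i
    simp only [Finset.mem_filter, Finset.mem_range, lt_min_iff]
    rw [and_comm]
    refine and_congr_left fun hi => ?_
    rw [min_eq_left (by omega), Nat.lt_succ_iff, ← Nat.le_div_iff_mul_le (by omega)]
    omega

theorem eval_div_of_le (h : a.eval m ≤ m.lim) : (div a b).eval m = a.eval m / b.eval m := by
  rw [eval_div, min_eq_left ((Nat.div_le_self _ _).trans h)]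

theorem eval_mod_of_le (h : a.eval m ≤ m.lim) : (mod a b).eval m = a.eval m % b.eval m := by
  rw [mod, eval_sub, eval_mul, eval_div_of_le h, min_eq_left ((Nat.div_le_self _ _).trans h),
    Nat.mod_eq_sub_div_mul]

end Term

/-- Entries are never overwritten later, so the memory in which entry `i` is computed already
contains the final entries below `i`. A term that looks only at these turns the filled array into a
solution of its own recursion equation. -/
theorem Cmd.run_fill (A x : ℕ) (e : Term) (m : Mem) :
    ((fill A x e).run m).lim = m.lim ∧
    (∀ B ≠ A, ((fill A x e).run m).arr B = m.arr B) ∧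
    (∀ i < m.lim, ∃ m' : Mem, m'.lim = m.lim ∧ m'.env x = i ∧ (∀ B ≠ A, m'.arr B = m.arr B) ∧
      (∀ j < i, m'.arr A j = ((fill A x e).run m).arr A j) ∧
      (∀ j, i ≤ j → m'.arr A j = m.arr A j) ∧
      ((fill A x e).run m).arr A i = e.eval m') ∧
    ∀ i, m.lim ≤ i → ((fill A x e).run m).arr A i = m.arr A i := by
  have h1 : ∀ k, (∀ B ≠ A, (m.fillTo A x e k).arr B = m.arr B) ∧
      (∀ j, k ≤ j → (m.fillTo A x e k).arr A j = m.arr A j) ∧ (m.fillTo A x e k).env x = k := by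
    intro k
    induction k with
    | zero => simp [Mem.fillTo]
    | succ k ih =>
      refine ⟨fun B hB => ?_, fun j hj => ?_, by simp [Mem.fillTo]⟩
      · simpa [Mem.fillTo, Mem.store, hB] using ih.1 B hB
      · simpa [Mem.fillTo, Mem.store, show j ≠ k by omega] using ih.2.1 j (by omega)
  have h2 : ∀ k l, k ≤ l → ∀ j < k,
      (m.fillTo A x e l).arr A j = (m.fillTo A x e k).arr A j := by
    intro k l hkl
    induction l, hkl using Nat.le_induction with
    | base => simp
    | succ l hl ih =>
      intro j hj
      simpa [Mem.fillTo, Mem.store, show j ≠ l by omega] using ih j hj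
  refine ⟨m.fillTo_lim A x e _, (h1 _).1, fun i hi => ⟨m.fillTo A x e i, m.fillTo_lim A x e _,
    (h1 i).2.2, (h1 i).1, fun j hj => (h2 _ _ hi.le j hj).symm, (h1 i).2.1, ?_⟩, (h1 _).2.1⟩
  exact (h2 (i + 1) m.lim hi i (by omega)).trans (by simp [Mem.fillTo, Mem.store])

end RAM

/-! ## Codes of labellings -/

/-- The digit of `x` stands at position `Nat.count X x` instead of `x`. Thus elements outside `X`
take no room and the number of codes depends on the size of `X`, not on `n`. -/
theorem exists_digits (B n : ℕ) (X : ℕ → Prop) [DecidablePred X] (g : ℕ → ℕ)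
    (hg : ∀ x < n, X x → g x < B) :
    ∃ c < B ^ Nat.count X n, ∀ x < n, X x → c / B ^ Nat.count X x % B = g x := by
  induction n with
  | zero => exact ⟨0, by simp, by simp⟩
  | succ n ih =>
    obtain ⟨c, hc, h⟩ := ih fun x hx => hg x (by omega)
    by_cases hX : X n
    · have hB := hg n (by omega) hX
      refine ⟨c + g n * B ^ Nat.count X n, ?_, fun x hx hXx => ?_⟩
      · rw [Nat.count_succ, if_pos hX, pow_succ]
        calc c + g n * B ^ Nat.count X n < (g n + 1) * B ^ Nat.count X n := by
              rw [Nat.add_mul]; omega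
          _ ≤ B * B ^ Nat.count X n := by gcongr; omega
          _ = _ := mul_comm _ _
      · have hpos : 0 < B := by omega
        rcases (Nat.lt_succ_iff_lt_or_eq.1 hx) with hx | rfl
        · obtain ⟨k, hk⟩ := Nat.exists_eq_add_of_lt
            (Nat.count_strict_mono hXx hx)
          rw [hk,
            show g n * B ^ (Nat.count X x + k + 1) = B ^ Nat.count X x * (B * (g n * B ^ k)) by
            ring, Nat.add_mul_div_left _ _ (by positivity), Nat.add_mul_mod_self_left]
          exact h x hx hXx
        · rw [mul_comm, Nat.add_mul_div_left _ _ (by positivity), Nat.div_eq_of_lt hc, zero_add,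
            Nat.mod_eq_of_lt hB]
    · refine ⟨c, by rwa [Nat.count_succ, if_neg hX], fun x hx hXx => h x ?_ hXx⟩
      rcases (Nat.lt_succ_iff_lt_or_eq.1 hx) with hx | rfl
      · exact hx
      · exact absurd hXx hX

/-- Number the values of `sig` other than `b` from `1` on and keep `0` for `b`. At most `X.card`
values occur on `X`. -/
theorem exists_labelling {α β : Type*} (X : Finset α) (sig : α → β) (b : β) :
    ∃ f : α → ℕ, (∀ x ∈ X, f x ≤ X.card) ∧ (∀ x ∈ X, f x = 0 ↔ sig x = b) ∧
      ∀ x ∈ X, ∀ y ∈ X, f x = f y ↔ sig x = sig y := by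
  classical
  set Z := (X.image sig).erase b
  have hZ : ∀ x ∈ X, sig x ∈ Z ↔ sig x ≠ b := fun x hx => by
    simp only [Z, Finset.mem_erase, Finset.mem_image]
    exact ⟨fun h => h.1, fun h => ⟨h, x, hx, rfl⟩⟩
  have hcard : Z.card ≤ X.card := (Finset.card_erase_le).trans Finset.card_image_le
  refine ⟨fun x => if h : sig x ∈ Z then Z.equivFin ⟨sig x, h⟩ + 1 else 0, fun x hx => ?_,
    fun x hx => ?_, fun x hx y hy => ?_⟩
  · dsimp only
    split_ifs with h
    · have := (Z.equivFin ⟨sig x, h⟩).2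
      omega
    · omega
  · dsimp only
    split_ifs with h
    · simpa using (hZ x hx).1 h
    · simpa using fun h' => h ((hZ x hx).2 h')
  · dsimp only
    have h1 := hZ x hx
    have h2 := hZ y hy
    split_ifs with hx' hy' hy'
    · simp [Fin.val_inj]
    · simp only [false_iff]
      exact fun h => hy' (h ▸ hx')
    · simp only [false_iff]
      exact fun h => hx' (h ▸ hy')
    · simp only [true_iff]
      rw [not_iff_not.2 h1, not_not] at hx'
      rw [not_iff_not.2 h2, not_not] at hy'
      exact hx'.trans hy'.symm

/-- The label of `x` in the labelling of the elements of `X` with the code `c`. -/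
def label (B : ℕ) (X : ℕ → Prop) [DecidablePred X] (c x : ℕ) : ℕ := c / B ^ Nat.count X x % B

theorem exists_label_code {β : Type*} {B n : ℕ} {X : ℕ → Prop} [DecidablePred X]
    (hB : Nat.count X n < B) (sig : ℕ → β) (b : β) :
    ∃ c < B ^ Nat.count X n, (∀ x < n, X x → (label B X c x = 0 ↔ sig x = b)) ∧
      ∀ x < n, X x → ∀ y < n, X y → (label B X c x = label B X c y ↔ sig x = sig y) := by
  obtain ⟨f, h1, h2, h3⟩ := exists_labelling ((Finset.range n).filter X) sig b
  simp only [Finset.mem_filter, Finset.mem_range, ← Nat.count_eq_card_filter_range,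
    and_imp] at h1 h2 h3
  obtain ⟨c, hc, h⟩ := exists_digits B n X f fun x hx hX => (h1 x hx hX).trans_lt hB
  refine ⟨c, hc, fun x hx hX => ?_, fun x hx hX y hy hY => ?_⟩
  · rw [label, h x hx hX, h2 x hx hX]
  · rw [label, label, h x hx hX, h y hy hY, h3 x hx hX y hy hY]

/-! ## Dynamic programming for Test Cover -/

/-- The chosen tests separate at least the pairs that the labelling separates. A state `s` consists
of the number `s / L` of chosen tests and the code `s % L` of a labelling. -/
theorem testCover_iff_of_reachable {u m k B L : ℕ} {t : ℕ → ℕ → Prop} {R : ℕ → Prop}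
    (hB : u < B) (hL : B ^ u ≤ L) (hm : m < L)
    (hR : ∀ s < L * L, R s ↔ s = 0 ∨ ∃ y < s, R y ∧ s / L = y / L + 1 ∧ ∃ j < m,
      ∀ x < u, ∀ z < u, label B (fun _ => True) (s % L) x ≠ label B (fun _ => True) (s % L) z →
        label B (fun _ => True) (y % L) x ≠ label B (fun _ => True) (y % L) z ∨
          Xor (t j x) (t j z)) :
    (∃ s < L * L, R s ∧ s / L ≤ k ∧ ∀ x < u, ∀ z < u, x ≠ z →
      label B (fun _ => True) (s % L) x ≠ label B (fun _ => True) (s % L) z) ↔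
    ∃ T : Finset ℕ, (∀ j ∈ T, j < m) ∧ T.card ≤ k ∧
      ∀ x < u, ∀ z < u, x ≠ z → ∃ j ∈ T, Xor (t j x) (t j z) := by
  classical
  constructor
  · rintro ⟨s, hs, hRs, hk, hf⟩
    have H : ∀ s, s < L * L → R s → ∃ T : Finset ℕ, (∀ j ∈ T, j < m) ∧ T.card ≤ s / L ∧
        ∀ x < u, ∀ z < u, label B (fun _ => True) (s % L) x ≠ label B (fun _ => True) (s % L) z →
          ∃ j ∈ T, Xor (t j x) (t j z) := by
      intro s
      induction s using Nat.strong_induction_on with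
      | _ s ih =>
        intro hs hRs
        rcases (hR s hs).1 hRs with rfl | ⟨y, hy, hRy, hsy, j, hj, hst⟩
        · exact ⟨∅, by simp, by simp, by simp [label]⟩
        · obtain ⟨T, h1, h2, h3⟩ := ih y hy (hy.trans hs) hRy
          refine ⟨insert j T, by simpa [hj] using h1, (Finset.card_insert_le _ _).trans (by omega),
            fun x hx z hz hxz => ?_⟩
          rcases hst x hx z hz hxz with h | h
          · obtain ⟨i, hi, h⟩ := h3 x hx z hz h
            exact ⟨i, Finset.mem_insert_of_mem hi, h⟩
          · exact ⟨j, Finset.mem_insert_self _ _, h⟩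
    obtain ⟨T, h1, h2, h3⟩ := H s hs hRs
    exact ⟨T, h1, h2.trans hk, fun x hx z hz hxz => h3 x hx z hz (hf x hx z hz hxz)⟩
  · rintro ⟨T, h1, h2, h3⟩
    have H : ∀ T : Finset ℕ, (∀ j ∈ T, j < m) → ∃ s < L * L, R s ∧ s / L = T.card ∧
        ∀ x < u, ∀ z < u, label B (fun _ => True) (s % L) x = label B (fun _ => True) (s % L) z ↔
          ∀ j ∈ T, (t j x ↔ t j z) := by
      intro T
      induction T using Finset.induction_on with
      | empty =>
        intro _
        have h0 : 0 < L * L := Nat.mul_pos (by omega) (by omega)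
        exact ⟨0, h0, (hR 0 h0).2 (.inl rfl), by simp, by simp [label]⟩
      | insert j T hj ih =>
        intro hT
        obtain ⟨y, hy, hRy, hyT, hlab⟩ := ih fun i hi => hT i (Finset.mem_insert_of_mem hi)
        -- The label of an item encodes the set of chosen tests that contain it, so equal labels
        -- mean that no chosen test separates.
        obtain ⟨c, hc, -, hc'⟩ := exists_label_code (B := B) (n := u) (X := fun _ => True)
          (by simpa using hB) (fun x => (insert j T).filter fun i => t i x) ∅
        have hcL : c < L := by simp at hc; omega
        -- Together with `m < L` this keeps the number of chosen tests below `L`, so that the state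
        -- stays below `L * L`.
        have hcard : (insert j T).card ≤ m := by
          simpa using Finset.card_le_card (show insert j T ⊆ Finset.range m from
            fun i hi => Finset.mem_range.2 (hT i hi))
        have hdiv : (c + L * (T.card + 1)) / L = T.card + 1 := by
          rw [Nat.add_mul_div_left _ _ (by omega), Nat.div_eq_of_lt hcL, zero_add]
        have hmod : (c + L * (T.card + 1)) % L = c := by
          rw [Nat.add_mul_mod_self_left, Nat.mod_eq_of_lt hcL]
        rw [Finset.card_insert_of_notMem hj] at hcard ⊢
        have hlt : c + L * (T.card + 1) < L * L := by
          calc c + L * (T.card + 1) < L + L * (T.card + 1) := by omega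
            _ = L * (T.card + 1 + 1) := by ring
            _ ≤ L * L := by gcongr; omega
        have hsig : ∀ x < u, ∀ z < u, label B (fun _ => True) c x = label B (fun _ => True) c z ↔
          ∀ i ∈ insert j T, (t i x ↔ t i z) := by
          intro x hx z hz
          rw [hc' x hx trivial z hz trivial, Finset.ext_iff]
          simp only [Finset.mem_filter]
          exact ⟨fun h i hi => by simpa [hi] using h i, fun h i => and_congr_right (h i)⟩
        refine ⟨c + L * (T.card + 1), hlt,
          (hR _ hlt).2 (.inr ⟨y, ?_, hRy, ?_, j, hT j (by simp), ?_⟩),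
          hdiv, by rw [hmod]; exact hsig⟩
        -- The predecessor is the smaller number because its quotient by `L` is smaller.
        · by_contra! h
          have := Nat.div_le_div_right (c := L) h
          omega
        · omega
        · rw [hmod]
          intro x hx z hz h
          by_contra! h'
          obtain ⟨h4, h5⟩ := h'
          refine h ((hsig x hx z hz).2 fun i hi => ?_)
          rcases Finset.mem_insert.1 hi with rfl | hi
          · rw [not_xor] at h5; exact h5
          · exact (hlab x hx z hz).1 h4 i hi
    obtain ⟨s, h4, h5, h6, h7⟩ := H T h1
    refine ⟨s, h4, h5, h6.trans_le h2, fun x hx z hz hxz h => ?_⟩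
    obtain ⟨j, hj, h8⟩ := h3 x hx z hz hxz
    exact (not_xor _ _).2 ((h7 x hx z hz).1 h j hj) h8

/-! ### Reading a label from a code -/

namespace RAM.Term

/-- The term for `label`, if the powers of `B` are in the array `1` and `B` in the array `2`. -/
def label (c x : Term) : Term := mod (div c (get 1 x)) (get 2 (const 0))

theorem eval_label {c x : Term} {m : Mem} (h : c.eval m ≤ m.lim) :
    (label c x).eval m = c.eval m / m.arr 1 (x.eval m) % m.arr 2 0 := by
  have h1 : (div c (get 1 x)).eval m ≤ m.lim := by
    rw [eval_div_of_le h]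
    exact (Nat.div_le_self _ _).trans h
  rw [label, eval_mod_of_le h1, eval_div_of_le h]
  rfl

end RAM.Term

/-! ## The program for Test Cover -/

namespace RAM.TestCover

open Term

def items : Term := get 0 (const 0)
def tests : Term := get 0 (const 1)
def budget : Term := get 0 (const 2)
-- The power bounds the number of labellings. The other summands put the numbers of items and tests
-- below the radix as well, so that quantifiers bounded by `lim` reach all of them.
def radix : Term := add (get 1 items) (add items (add tests (const 1)))
def mem (j x : Term) : Term := get 0 (add (const 3) (add (mul j items) x))
def lab (s x : Term) : Term := Term.label (mod s radix) x

/-- State `0` can be extended by the test `2` to state `1`. -/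
def step (y s : Term) : Term :=
  and (eq (div s radix) (add (div y radix) (const 1))) <| ex 2 <| and (lt (var 2) tests) <|
    all 3 <| imp (lt (var 3) items) <| all 4 <| imp (lt (var 4) items) <|
      imp (not (eq (lab s (var 3)) (lab s (var 4)))) <|
        or (not (eq (lab y (var 3)) (lab y (var 4))))
          (or (and (mem (var 2) (var 3)) (not (mem (var 2) (var 4))))
            (and (mem (var 2) (var 4)) (not (mem (var 2) (var 3)))))

def reachable : Term :=
  or (eq (var 0) (const 0)) <| ex 1 <| and (lt (var 1) (var 0)) <| and (get 3 (var 1)) <|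
    step (var 1) (var 0)

def answer : Term :=
  ex 0 <| and (get 3 (var 0)) <| and (not (lt budget (div (var 0) radix))) <|
    all 3 <| imp (lt (var 3) items) <| all 4 <| imp (lt (var 4) items) <|
      imp (not (eq (var 3) (var 4))) (not (eq (lab (var 0) (var 3)) (lab (var 0) (var 4))))

def cmds : List Cmd :=
  [.setLim (add items (const 1)),
   -- At this point `lim = u + 1` is both the base of the powers and the number of exponents needed,
   -- which are `0` to `u`.
   .fill 1 0 (ite (var 0) (mul lim (get 1 (sub (var 0) (const 1)))) (const 1)),
   .fill 2 0 lim,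
   .setLim radix,
   -- Squares the bound.
   .setLim (sum 0 lim),
   .fill 3 0 reachable]

/-- The memory before the dynamic programming table is filled. -/
structure Ready (u m k L : ℕ) (t : ℕ → ℕ → Prop) (M : Mem) : Prop where
  lim : M.lim = L * L
  items : M.arr 0 0 = u
  tests : M.arr 0 1 = m
  budget : M.arr 0 2 = k
  mem : ∀ j < m, ∀ x < u, M.arr 0 (3 + (j * u + x)) ≠ 0 ↔ t j x
  pow : ∀ x ≤ u, M.arr 1 x = (u + 1) ^ x
  base : M.arr 2 0 = u + 1
  radix : L = (u + 1) ^ u + (u + (m + 1))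

/-! ### Meaning of the terms for Test Cover -/

variable {u m k L : ℕ} {t : ℕ → ℕ → Prop} {M : Mem}

theorem Ready.bind (h : Ready u m k L t M) (x v : ℕ) : Ready u m k L t (M.bind x v) :=
  ⟨h.lim, h.items, h.tests, h.budget, h.mem, h.pow, h.base, h.radix⟩

/-- The array `3` is exempt since it holds the table being filled. -/
theorem Ready.of_eq {M' : Mem} (h : Ready u m k L t M) (hl : M'.lim = M.lim)
    (ha : ∀ B ≠ 3, M'.arr B = M.arr B) : Ready u m k L t M' where
  lim := hl.trans h.lim
  items := by rw [ha 0 (by simp), h.items]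
  tests := by rw [ha 0 (by simp), h.tests]
  budget := by rw [ha 0 (by simp), h.budget]
  mem := by rw [ha 0 (by simp)]; exact h.mem
  pow := by rw [ha 1 (by simp)]; exact h.pow
  base := by rw [ha 2 (by simp), h.base]
  radix := h.radix

theorem Ready.eval_radix (h : Ready u m k L t M) : TestCover.radix.eval M = L := by
  simp [TestCover.radix, TestCover.items, TestCover.tests, h.items, h.tests, h.pow, ← h.radix]

theorem Ready.eval_div {s : Term} (h : Ready u m k L t M) (hs : s.eval M < L * L) :
    (div s TestCover.radix).eval M = s.eval M / L := by
  rw [eval_div_of_le (by rw [h.lim]; exact hs.le), h.eval_radix]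

theorem Ready.eval_lab {s x : Term} (h : Ready u m k L t M) (hs : s.eval M < L * L)
    (hx : x.eval M < u) :
    (lab s x).eval M = _root_.label (u + 1) (fun _ => True) (s.eval M % L) (x.eval M) := by
  have h1 : (mod s TestCover.radix).eval M = s.eval M % L := by
    rw [eval_mod_of_le (by rw [h.lim]; exact hs.le), h.eval_radix]
  have h2 : (mod s TestCover.radix).eval M ≤ M.lim := by
    rw [h1, h.lim]
    exact (Nat.mod_le _ _).trans hs.le
  rw [lab, Term.eval_label h2, h1, h.pow _ hx.le, h.base, _root_.label, Nat.count_true]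

theorem Ready.holds_mem {j x : Term} (h : Ready u m k L t M) (hj : j.eval M < m)
    (hx : x.eval M < u) : (TestCover.mem j x).Holds M ↔ t (j.eval M) (x.eval M) := by
  have hL : L ≤ L * L := Nat.le_mul_self L
  have := h.radix
  simp only [TestCover.mem, holds_get, eval_add, eval_mul, eval_const, TestCover.items, eval_get,
    h.items, h.lim]
  rw [min_eq_left (by omega), h.mem _ hj _ hx]

theorem Ready.holds_step {y s : ℕ} (h : Ready u m k L t M) (hy : y < L * L) (hs : s < L * L)
    (h1 : M.env 1 = y) (h0 : M.env 0 = s) : (step (var 1) (var 0)).Holds M ↔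
      s / L = y / L + 1 ∧ ∃ j < m, ∀ x < u, ∀ z < u,
        _root_.label (u + 1) (fun _ => True) (s % L) x ≠
          _root_.label (u + 1) (fun _ => True) (s % L) z →
        _root_.label (u + 1) (fun _ => True) (y % L) x ≠
          _root_.label (u + 1) (fun _ => True) (y % L) z ∨ Xor (t j x) (t j z) := by
  have hL : L ≤ L * L := Nat.le_mul_self L
  have hLr := h.radix
  simp only [step, holds_and, holds_eq, eval_add, eval_const, holds_ex, holds_all, holds_imp,
    holds_lt]
  rw [h.eval_div (by simpa [h0]), h.eval_div (by simpa [h1])]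
  simp only [eval_var, h0, h1]
  refine and_congr_right fun _ => ⟨?_, ?_⟩
  · rintro ⟨j, hj, hjm, H⟩
    have hjm : j < m := by simpa [TestCover.tests, h.tests] using hjm
    refine ⟨j, hjm, fun x hx z hz hxz => ?_⟩
    have hlim : M.lim = L * L := h.lim
    have h' := ((h.bind 2 j).bind 3 x).bind 4 z
    have := H x (by simp; omega) (by simpa [TestCover.items, h.items] using hx) z
      (by simp; omega) (by simpa [TestCover.items, h.items] using hz)
    simp only [holds_not, holds_eq, holds_or, holds_and] at this
    rw [h'.eval_lab (by simpa [h0]) (by simpa), h'.eval_lab (by simpa [h0]) (by simpa),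
      h'.eval_lab (by simpa [h1]) (by simpa), h'.eval_lab (by simpa [h1]) (by simpa),
      h'.holds_mem (by simpa) (by simpa), h'.holds_mem (by simpa) (by simpa)] at this
    simpa [h0, h1, Xor] using this (by simpa [h0] using hxz)
  · rintro ⟨j, hj, H⟩
    refine ⟨j, by rw [h.lim]; omega, by simpa [TestCover.tests, h.tests] using hj,
      fun x _ hx z _ hz => ?_⟩
    replace hx : x < u := by simpa [TestCover.items, h.items] using hx
    replace hz : z < u := by simpa [TestCover.items, h.items] using hz
    have h' := ((h.bind 2 j).bind 3 x).bind 4 z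
    simp only [holds_not, holds_eq, holds_or, holds_and]
    rw [h'.eval_lab (by simpa [h0]) (by simpa), h'.eval_lab (by simpa [h0]) (by simpa),
      h'.eval_lab (by simpa [h1]) (by simpa), h'.eval_lab (by simpa [h1]) (by simpa),
      h'.holds_mem (by simpa) (by simpa), h'.holds_mem (by simpa) (by simpa)]
    simpa [h0, h1, Xor] using H x hx z hz

theorem Ready.holds_answer (h : Ready u m k L t M) :
    answer.Holds ((Cmd.fill 3 0 reachable).run M) ↔
    ∃ T : Finset ℕ, (∀ j ∈ T, j < m) ∧ T.card ≤ k ∧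
      ∀ x < u, ∀ z < u, x ≠ z → ∃ j ∈ T, Xor (t j x) (t j z) := by
  obtain ⟨f1, f2, f3, -⟩ := Cmd.run_fill 3 0 reachable M
  set M' := (Cmd.fill 3 0 reachable).run M
  have hM' : Ready u m k L t M' := h.of_eq f1 f2
  have hLr := h.radix
  rw [h.lim] at f3
  -- The guard `y < s` in `reachable` means that only finished entries matter, so the term evaluated
  -- during the run gives an equation for the finished table.
  have hR : ∀ s < L * L, M'.arr 3 s ≠ 0 ↔ s = 0 ∨ ∃ y < s, M'.arr 3 y ≠ 0 ∧ s / L = y / L + 1 ∧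
      ∃ j < m, ∀ x < u, ∀ z < u, _root_.label (u + 1) (fun _ => True) (s % L) x ≠
          _root_.label (u + 1) (fun _ => True) (s % L) z →
        _root_.label (u + 1) (fun _ => True) (y % L) x ≠
          _root_.label (u + 1) (fun _ => True) (y % L) z ∨ Xor (t j x) (t j z) := by
    intro s hs
    obtain ⟨N, g1, g2, g3, g4, -, g6⟩ := f3 s hs
    have hN : Ready u m k L t N := h.of_eq (g1.trans h.lim.symm) g3
    rw [g6, ← holds_iff, reachable, holds_or, holds_eq, holds_ex]
    simp only [eval_var, g2, eval_const, holds_and, holds_lt, holds_get, Mem.bind_env, if_true,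
      Mem.bind_arr, hN.lim]
    refine or_congr_right ⟨?_, ?_⟩
    · rintro ⟨y, hy, hys, hRy, hst⟩
      simp only [zero_ne_one, if_false] at hys
      rw [(hN.bind 1 y).holds_step hy hs (by simp) (by simpa)] at hst
      exact ⟨y, hys, by rwa [← g4 y hys], hst⟩
    · rintro ⟨y, hys, hRy, hst⟩
      refine ⟨y, by omega, by simpa [g2], by rwa [g4 y hys], ?_⟩
      rw [(hN.bind 1 y).holds_step (hys.trans hs) hs (by simp) (by simpa)]
      exact hst
  have hL : L ≤ L * L := Nat.le_mul_self L
  rw [← testCover_iff_of_reachable (by omega) (by omega) (by omega) hR, answer, holds_ex, hM'.lim]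
  refine exists_congr fun s => and_congr_right fun hs => ?_
  simp only [holds_and, holds_get, holds_not, holds_lt, holds_all, holds_imp, holds_eq]
  rw [(hM'.bind 0 s).eval_div (by simpa)]
  refine and_congr (by simp) (and_congr (by simp [TestCover.budget, hM'.budget]) ⟨?_, ?_⟩)
  · intro H x hx z hz hxz
    have h' := ((hM'.bind 0 s).bind 3 x).bind 4 z
    have := H x (by simp [hM'.lim]; omega) (by simpa [TestCover.items, hM'.items] using hx) z
      (by simp [hM'.lim]; omega) (by simpa [TestCover.items, hM'.items] using hz) (by simpa)
    rw [h'.eval_lab (by simpa) (by simpa), h'.eval_lab (by simpa) (by simpa)] at this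
    simpa using this
  · intro H x _ hx z _ hz hxz
    replace hx : x < u := by simpa [TestCover.items, hM'.items] using hx
    replace hz : z < u := by simpa [TestCover.items, hM'.items] using hz
    have h' := ((hM'.bind 0 s).bind 3 x).bind 4 z
    rw [h'.eval_lab (by simpa) (by simpa), h'.eval_lab (by simpa) (by simpa)]
    simpa using H x hx z hz (by simpa using hxz)

theorem runAll_cmds {M : Mem} (h0 : M.lim = 0) (hu : M.arr 0 0 = u) (hm : M.arr 0 1 = m)
    (hk : M.arr 0 2 = k) (ht : ∀ j < m, ∀ x < u, M.arr 0 (3 + (j * u + x)) ≠ 0 ↔ t j x) :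
    Cmd.LimLe (((u + 1) ^ u + (u + (m + 1))) * ((u + 1) ^ u + (u + (m + 1)))) cmds M ∧
    (answer.Holds (Cmd.runAll cmds M) ↔ ∃ T : Finset ℕ, (∀ j ∈ T, j < m) ∧ T.card ≤ k ∧
      ∀ x < u, ∀ z < u, x ≠ z → ∃ j ∈ T, Xor (t j x) (t j z)) := by
  set L := (u + 1) ^ u + (u + (m + 1)) with hLdef
  set M₁ := (Cmd.setLim (add items (const 1))).run M with hM₁
  have l1 : M₁.lim = u + 1 := by simp [hM₁, Cmd.run, items, hu]
  have a1 : M₁.arr = M.arr := rfl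
  obtain ⟨l2, a2, f2, -⟩ := Cmd.run_fill 1 0
    (ite (var 0) (mul lim (get 1 (sub (var 0) (const 1)))) (const 1)) M₁
  set M₂ := (Cmd.fill 1 0 (ite (var 0) (mul lim (get 1 (sub (var 0) (const 1))))
    (const 1))).run M₁ with hM₂
  obtain ⟨l3, a3, f3, -⟩ := Cmd.run_fill 2 0 lim M₂
  set M₃ := (Cmd.fill 2 0 lim).run M₂ with hM₃
  set M₄ := (Cmd.setLim radix).run M₃ with hM₄
  set M₅ := (Cmd.setLim (sum 0 lim)).run M₄ with hM₅
  have ha : ∀ B, B ≠ 1 → B ≠ 2 → M₃.arr B = M.arr B := fun B h1 h2 => by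
    rw [a3 B h2, a2 B h1, a1]
  have hpow : ∀ x ≤ u, M₃.arr 1 x = (u + 1) ^ x := by
    rw [a3 1 (by simp)]
    intro x
    induction x with
    | zero =>
      intro _
      obtain ⟨N, g1, g2, -, -, -, g6⟩ := f2 0 (by omega)
      rw [g6]
      simp [g2, Holds]
    | succ x ih =>
      intro hx
      obtain ⟨N, g1, g2, -, g4, -, g6⟩ := f2 (x + 1) (by omega)
      rw [g6]
      simp [g2, Holds, g1, l1, g4 x, ih (by omega), pow_succ']
  have l4 : M₄.lim = L := by
    simp only [hM₄, Cmd.run, radix, items, tests, eval_add, eval_get, eval_const]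
    rw [ha 0 (by simp) (by simp), hu, hm, hpow u le_rfl]
  have l5 : M₅.lim = L * L := by
    simp [hM₅, Cmd.run, l4]
  have hready : Ready u m k L t M₅ := by
    have h0 : M₅.arr 0 = M.arr 0 := ha 0 (by simp) (by simp)
    refine ⟨l5, by rw [h0, hu], by rw [h0, hm], by rw [h0, hk], by rw [h0]; exact ht,
      hpow, ?_, hLdef⟩
    obtain ⟨N, g1, -, -, -, -, g6⟩ := f3 0 (by omega)
    exact g6.trans (by simp [g1, l2, l1])
  refine ⟨?_, ?_⟩
  · have hL : L ≤ L * L := Nat.le_mul_self L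
    have hu : u + 1 ≤ L := by omega
    refine ⟨by omega, ?_, ?_, ?_, ?_, ?_, ?_⟩
    · exact (l1.le.trans hu).trans hL
    · exact ((l2.trans l1).le.trans hu).trans hL
    · exact ((l3.trans (l2.trans l1)).le.trans hu).trans hL
    · exact l4.le.trans hL
    · exact l5.le
    · exact ((Cmd.run_fill 3 0 reachable M₅).1.trans l5).le
  · exact hready.holds_answer

end RAM.TestCover

/-! ## Running times -/

/-- The exponential factor is a power of `v ^ v`, which reduces the time analysis to natural
numbers. At `v = 0` the conventions `logb 2 0 = 0` and `0 ^ 0 = 1` agree. -/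
theorem two_rpow_mul_logb (v c : ℕ) :
    (2 : ℝ) ^ ((c : ℝ) * ((v : ℝ) * Real.logb 2 (v : ℝ))) = (((v ^ v) ^ c : ℕ) : ℝ) := by
  rcases Nat.eq_zero_or_pos v with rfl | hv
  · simp
  · have hv' : (0 : ℝ) < v := by exact_mod_cast hv
    rw [show (c : ℝ) * ((v : ℝ) * Real.logb 2 (v : ℝ)) = Real.logb 2 v * ((v * c : ℕ) : ℝ) by
      push_cast; ring, Real.rpow_mul (by norm_num), Real.rpow_logb (by norm_num) (by norm_num) hv',
      Real.rpow_natCast]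
    push_cast
    rw [pow_mul]

theorem exists_time_bound (K C a b : ℕ) : ∃ c : ℕ, ∀ v n M t : ℕ,
    M + 1 ≤ C * (v ^ v) ^ a * (n + 1) ^ b → t ≤ K * (M + 1) ^ K →
    (t : ℝ) ≤ (c : ℝ) * (2 : ℝ) ^ ((c : ℝ) * ((v : ℝ) * Real.logb 2 (v : ℝ))) *
      ((n : ℝ) + 1) ^ c := by
  -- One constant that dominates the factor and both exponents after raising the bound for `M + 1`
  -- to the power `K`.
  refine ⟨K * C ^ K + a * K + b * K, fun v n M t hM ht => ?_⟩
  set c := K * C ^ K + a * K + b * K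
  rw [two_rpow_mul_logb]
  have hv : 1 ≤ v ^ v := Nat.pow_self_pos
  have : t ≤ c * (v ^ v) ^ c * (n + 1) ^ c := by
    calc t ≤ K * (C * (v ^ v) ^ a * (n + 1) ^ b) ^ K := ht.trans (by gcongr)
      _ = (K * C ^ K) * (v ^ v) ^ (a * K) * (n + 1) ^ (b * K) := by
        rw [mul_pow, mul_pow, ← pow_mul, ← pow_mul]; ring
      _ ≤ c * (v ^ v) ^ c * (n + 1) ^ c := by
        gcongr <;> omega
  exact_mod_cast this

/-! ### Running time and correctness for Test Cover -/

namespace RAM.TestCover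

theorem lim_le (u m : ℕ) : ((u + 1) ^ u + (u + (m + 1))) * ((u + 1) ^ u + (u + (m + 1))) + 1 ≤
    10 * (u ^ u) ^ 4 * (u + m + 1) ^ 2 := by
  have hV : 1 ≤ u ^ u := Nat.pow_self_pos
  -- For `u ≥ 2` this follows from `u + 1 ≤ u ^ 2`; the factor `2` is needed for `u = 1`.
  have h : (u + 1) ^ u ≤ 2 * (u ^ u) ^ 2 := by
    rcases u with _ | _ | u
    · simp
    · simp
    · calc (u + 2 + 1) ^ (u + 2) ≤ ((u + 2) ^ 2) ^ (u + 2) := by gcongr; nlinarith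
        _ = ((u + 2) ^ (u + 2)) ^ 2 := by rw [← pow_mul, ← pow_mul, mul_comm]
        _ ≤ _ := Nat.le_mul_of_pos_left _ (by norm_num)
  have hV2 : 1 ≤ (u ^ u) ^ 2 := Nat.one_le_pow _ _ hV
  set V := u ^ u
  have h1 : (u + 1) ^ u + (u + (m + 1)) ≤ 3 * V ^ 2 * (u + m + 1) := by
    nlinarith [Nat.mul_le_mul hV2 (Nat.zero_le (u + m)), Nat.mul_le_mul_right (u + m) hV2]
  have h2 : 1 ≤ V ^ 4 * (u + m + 1) ^ 2 :=
    Nat.mul_pos (Nat.pow_pos hV) (by positivity)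
  calc _ ≤ (3 * V ^ 2 * (u + m + 1)) * (3 * V ^ 2 * (u + m + 1)) + V ^ 4 * (u + m + 1) ^ 2 := by
        gcongr
    _ = _ := by ring

theorem testCover_iff {u m : ℕ} (F : Fin m → Finset (Fin u)) (k : ℕ) :
    (∃ T : Finset ℕ, (∀ j ∈ T, j < m) ∧ T.card ≤ k ∧ ∀ x < u, ∀ z < u, x ≠ z → ∃ j ∈ T,
      Xor (∃ (hj : j < m) (hx : x < u), (⟨x, hx⟩ : Fin u) ∈ F ⟨j, hj⟩)
        (∃ (hj : j < m) (hx : z < u), (⟨z, hx⟩ : Fin u) ∈ F ⟨j, hj⟩)) ↔ TestCover F k := by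
  classical
  constructor
  · rintro ⟨T, h1, h2, h3⟩
    refine ⟨T.attachFin h1, by simpa, fun x y hxy => ?_⟩
    obtain ⟨j, hj, h⟩ := h3 x x.2 y y.2 (by simpa [Fin.ext_iff] using hxy)
    refine ⟨⟨j, h1 j hj⟩, by simpa, ?_⟩
    simpa [h1 j hj] using h
  · rintro ⟨T, h1, h2⟩
    refine ⟨T.map Fin.valEmbedding, by simp, by simpa, fun x hx z hz hxz => ?_⟩
    obtain ⟨j, hj, h⟩ := h2 ⟨x, hx⟩ ⟨z, hz⟩ (by simpa)
    exact ⟨j, Finset.mem_map_of_mem Fin.valEmbedding hj, by simpa [hx, hz] using h⟩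

theorem exists_prog : ∃ (P : Prog) (c : ℕ), ∀ (u m : ℕ) (F : Fin m → Finset (Fin u)) (k : ℕ),
    P.DecidesInTime (testCoverInput F k) (TestCover F k)
      ((c : ℝ) * (2 : ℝ) ^ ((c : ℝ) * ((u : ℝ) * Real.logb 2 (u : ℝ))) *
        ((u : ℝ) + (m : ℝ) + 1) ^ c) := by
  obtain ⟨K, hK⟩ := Cmd.exists_toProg_ends cmds (.ite answer (.const 1) (.const 0))
  obtain ⟨c, hc⟩ := exists_time_bound K 10 4 2
  refine ⟨Cmd.toProg cmds (.ite answer (.const 1) (.const 0)), c, fun u m F k => ?_⟩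
  obtain ⟨h1, h2⟩ := runAll_cmds (u := u) (m := m) (k := k)
    (t := fun j x => ∃ (hj : j < m) (hx : x < u), (⟨x, hx⟩ : Fin u) ∈ F ⟨j, hj⟩)
    (M := (State.init (testCoverInput F k)).mem) rfl rfl rfl rfl (by
      intro j hj x hx
      have hlt : j * u + x < m * u := by
        calc j * u + x < (j + 1) * u := by rw [Nat.add_mul]; omega
          _ ≤ m * u := by gcongr; omega
      have h1 : (j * u + x) / u = j := by
        rw [mul_comm, Nat.mul_add_div (by omega), Nat.div_eq_of_lt hx, add_zero]
      have h2 : (j * u + x) % u = x := by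
        rw [mul_comm, Nat.mul_add_mod, Nat.mod_eq_of_lt hx]
      -- With `3` as the right summand, `simp` can strip the three header entries off the input
      -- list.
      rw [add_comm 3]
      simp [State.mem, State.init, testCoverInput, List.getD_eq_getElem?_getD, hlt, Fin.divNat,
        Fin.modNat, h1, h2, hj, hx])
  rw [testCover_iff] at h2
  obtain ⟨t, s', h3, h4, h5⟩ := hK _ _ h1
  refine ⟨t, s', h3, ?_, fun h => ?_, fun h => ?_⟩
  · exact_mod_cast hc u (u + m) _ t (lim_le u m) h4
  · rw [h5, Term.eval_ite, if_pos (h2.2 h)]; rfl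
  · rw [h5, Term.eval_ite, if_neg (h2.not.2 h)]; rfl

end RAM.TestCover

/-! ## Dynamic programming for Locating-Dominating Set -/

namespace LDS

/-- A finite graph on `{0, …, n - 1}` with a vertex cover. -/
structure CoveredGraph where
  n : ℕ
  adj : ℕ → ℕ → Prop
  cover : ℕ → Prop
  adj_lt : ∀ {u v}, adj u v → u < n ∧ v < n
  adj_symm : ∀ {u v}, adj u v → adj v u
  isCover : ∀ {u v}, adj u v → cover u ∨ cover v

namespace CoveredGraph

variable (G : CoveredGraph) (g : ℕ → ℕ)

structure LocDom (S : Finset ℕ) : Prop where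
  lt : ∀ v ∈ S, v < G.n
  dom : ∀ v < G.n, v ∈ S ∨ ∃ w ∈ S, G.adj v w
  loc : ∀ u < G.n, ∀ v < G.n, u ∉ S → v ∉ S → u ≠ v → ∃ w ∈ S, ¬ (G.adj u w ↔ G.adj v w)

/-! A guess `g` assigns to the vertices of the cover the value `1` if they belong to the solution,
and `2` if they have to be adjacent to vertices of the solution outside the cover. -/

/-- The vertices have the same neighbours in the part of the solution inside the cover. -/
def Same (u v : ℕ) : Prop := ∀ w < G.n, G.cover w → g w = 1 → (G.adj u w ↔ G.adj v w)

/-- The vertex `v` outside the cover belongs to the class of `j`, and `j` is the least vertex with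
its neighbourhood. -/
def InClass (j v : ℕ) : Prop :=
  v < G.n ∧ ¬ G.cover v ∧ G.Same g v j ∧ ∀ i < j, ¬ G.Same g i j

/-- The vertex `v` outside the cover may be left out of the solution. -/
def Omittable (v : ℕ) : Prop :=
  (∃ w < G.n, G.cover w ∧ g w = 1 ∧ G.adj v w) ∧
    ∀ x < G.n, G.cover x → g x ≠ 1 → G.Same g x v → g x = 2

/-- The transition at the class of `j`: the vertex `e` of this class (or none, if `e = n`) is left
out. The number of omitted vertices changes from `q` to `q'`, the labelling from `f` to `f'`. -/
def Step (j q : ℕ) (f : ℕ → ℕ) (q' : ℕ) (f' : ℕ → ℕ) : Prop :=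
  ∃ e ≤ G.n, ((e = G.n ∧ q' = q) ∨ (q' = q + 1 ∧ G.InClass g j e ∧ G.Omittable g e)) ∧
    (∀ x < G.n, G.cover x → f' x ≠ 0 →
      f x ≠ 0 ∨ ∃ w < G.n, G.InClass g j w ∧ w ≠ e ∧ G.adj w x) ∧
    ∀ x < G.n, G.cover x → ∀ y < G.n, G.cover y → f' x ≠ f' y →
      f x ≠ f y ∨ ∃ w < G.n, G.InClass g j w ∧ w ≠ e ∧ ¬ (G.adj w x ↔ G.adj w y)

open Classical in
/-- The final labelling `f` proves that the guess is right. -/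
def Accepts (k q : ℕ) (f : ℕ → ℕ) : Prop :=
  k + ((Finset.range G.n).filter fun x => G.cover x ∧ g x ≠ 1).card + q = G.n ∧
    (∀ x < G.n, G.cover x → g x ≠ 1 →
      (f x ≠ 0 ∨ ∃ w < G.n, G.cover w ∧ g w = 1 ∧ G.adj x w) ∧ (g x = 2 → f x ≠ 0)) ∧
    ∀ x < G.n, G.cover x → g x ≠ 1 → ∀ y < G.n, G.cover y → g y ≠ 1 → x ≠ y →
      f x ≠ f y ∨ ¬ G.Same g x y

/-- The index `j` runs through all vertices, also those of the cover, and a class is treated at the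
least vertex with its neighbourhood. A vertex outside the cover becomes handled exactly at the step
where it satisfies `InClass`. -/
def Handled (j v : ℕ) : Prop := ∃ i < j, G.Same g i v

variable {G g}

theorem Same.refl (u : ℕ) : G.Same g u u := fun _ _ _ _ => Iff.rfl

theorem Same.symm {u v : ℕ} (h : G.Same g u v) : G.Same g v u :=
  fun w h1 h2 h3 => (h w h1 h2 h3).symm

theorem Same.trans {u v w : ℕ} (h : G.Same g u v) (h' : G.Same g v w) : G.Same g u w :=
  fun x h1 h2 h3 => (h x h1 h2 h3).trans (h' x h1 h2 h3)

theorem InClass.not_handled {j v : ℕ} (h : G.InClass g j v) : ¬ G.Handled g j v := by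
  rintro ⟨i, hi, h'⟩
  exact h.2.2.2 i hi (h'.trans h.2.2.1)

theorem InClass.handled {j v : ℕ} (h : G.InClass g j v) : G.Handled g (j + 1) v :=
  ⟨j, by omega, h.2.2.1.symm⟩

theorem Handled.mono {i j v : ℕ} (h : G.Handled g i v) (hij : i ≤ j) : G.Handled g j v := by
  obtain ⟨l, hl, h⟩ := h
  exact ⟨l, by omega, h⟩

theorem Handled.of_succ {j v : ℕ} (h : G.Handled g (j + 1) v) (hv : v < G.n)
    (hc : ¬ G.cover v) : G.Handled g j v ∨ G.InClass g j v := by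
  obtain ⟨i, hi, h⟩ := h
  by_cases hp : G.Handled g j v
  · exact .inl hp
  · rcases Nat.lt_succ_iff_lt_or_eq.1 hi with hi | rfl
    · exact .inl ⟨i, hi, h⟩
    · exact .inr ⟨hv, hc, h.symm, fun l hl h' => hp ⟨l, hl, h'.trans h⟩⟩

theorem not_adj {u v : ℕ} (hu : ¬ G.cover u) (hv : ¬ G.cover v) : ¬ G.adj u v :=
  fun h => (G.isCover h).elim hu hv

/-! ### Soundness: from a run of the dynamic program to a solution -/

variable (G g) in
/-- The set `E` of omitted vertices realizes the state. -/
structure Realizes (E : Finset ℕ) (j q : ℕ) (f : ℕ → ℕ) : Prop where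
  card : E.card = q
  lt : ∀ e ∈ E, e < G.n
  not_cover : ∀ e ∈ E, ¬ G.cover e
  handled : ∀ e ∈ E, G.Handled g j e
  omittable : ∀ e ∈ E, G.Omittable g e
  unique : ∀ e ∈ E, ∀ e' ∈ E, G.Same g e e' → e = e'
  touched : ∀ x < G.n, G.cover x → f x ≠ 0 →
    ∃ w < G.n, ¬ G.cover w ∧ G.Handled g j w ∧ w ∉ E ∧ G.adj w x
  separated : ∀ x < G.n, G.cover x → ∀ y < G.n, G.cover y → f x ≠ f y →
    ∃ w < G.n, ¬ G.cover w ∧ G.Handled g j w ∧ w ∉ E ∧ ¬ (G.adj w x ↔ G.adj w y)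

theorem Realizes.zero {f : ℕ → ℕ} (hf : ∀ x, f x = 0) : G.Realizes g ∅ 0 0 f := by
  constructor <;> simp [hf]

/-- The class of `j` is disjoint from the vertices handled before. Hence omitting `e` spoils no
earlier witness, the earlier omissions spoil none of the new ones, and no class loses two vertices.
-/
theorem Realizes.step {E : Finset ℕ} {j q q' : ℕ} {f f' : ℕ → ℕ} (h : G.Realizes g E j q f)
    (hs : G.Step g j q f q' f') : ∃ E', G.Realizes g E' (j + 1) q' f' := by
  classical
  obtain ⟨e, he, hcase, h1, h2⟩ := hs
  rcases hcase with ⟨rfl, rfl⟩ | ⟨rfl, hcl, hom⟩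
  · refine ⟨E, h.card, h.lt, h.not_cover, fun e he => (h.handled e he).mono (by omega),
      h.omittable, h.unique, fun x hx hc hf => ?_, fun x hx hc y hy hcy hf => ?_⟩
    · rcases h1 x hx hc hf with h3 | ⟨w, hw, hcl, -, h3⟩
      · obtain ⟨w, hw, hcw, hp, hE, h3⟩ := h.touched x hx hc h3
        exact ⟨w, hw, hcw, hp.mono (by omega), hE, h3⟩
      · exact ⟨w, hw, hcl.2.1, hcl.handled, fun hE => hcl.not_handled (h.handled w hE), h3⟩
    · rcases h2 x hx hc y hy hcy hf with h3 | ⟨w, hw, hcl, -, h3⟩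
      · obtain ⟨w, hw, hcw, hp, hE, h3⟩ := h.separated x hx hc y hy hcy h3
        exact ⟨w, hw, hcw, hp.mono (by omega), hE, h3⟩
      · exact ⟨w, hw, hcl.2.1, hcl.handled, fun hE => hcl.not_handled (h.handled w hE), h3⟩
  · have heE : e ∉ E := fun hE => hcl.not_handled (h.handled e hE)
    have hnew : ∀ w, G.InClass g j w → w ≠ e → w ∉ insert e E := fun w hw hne hE => by
      rcases Finset.mem_insert.1 hE with h' | hE
      · exact hne h'
      · exact hw.not_handled (h.handled w hE)
    have hold : ∀ w, G.Handled g j w → w ∉ E → w ∉ insert e E := fun w hw hne hE => by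
      rcases Finset.mem_insert.1 hE with rfl | hE
      · exact hcl.not_handled hw
      · exact hne hE
    refine ⟨insert e E, by rw [Finset.card_insert_of_notMem heE, h.card],
      Finset.forall_mem_insert _ _ _ |>.2 ⟨hcl.1, h.lt⟩,
      Finset.forall_mem_insert _ _ _ |>.2 ⟨hcl.2.1, h.not_cover⟩,
      Finset.forall_mem_insert _ _ _ |>.2
        ⟨hcl.handled, fun e he => (h.handled e he).mono (by omega)⟩,
      Finset.forall_mem_insert _ _ _ |>.2 ⟨hom, h.omittable⟩, ?_,
      fun x hx hc hf => ?_, fun x hx hc y hy hcy hf => ?_⟩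
    · have key : ∀ e' ∈ E, ¬ G.Same g e' e := fun e' he' hs => by
        obtain ⟨i, hi, h3⟩ := h.handled e' he'
        exact hcl.not_handled ⟨i, hi, h3.trans hs⟩
      intro a ha b hb hs
      rcases Finset.mem_insert.1 ha with rfl | ha' <;> rcases Finset.mem_insert.1 hb with rfl | hb'
      · rfl
      · exact absurd hs.symm (key b hb')
      · exact absurd hs (key a ha')
      · exact h.unique a ha' b hb' hs
    · rcases h1 x hx hc hf with h3 | ⟨w, hw, hcl', hne, h3⟩
      · obtain ⟨w, hw, hcw, hp, hE, h3⟩ := h.touched x hx hc h3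
        exact ⟨w, hw, hcw, hp.mono (by omega), hold w hp hE, h3⟩
      · exact ⟨w, hw, hcl'.2.1, hcl'.handled, hnew w hcl' hne, h3⟩
    · rcases h2 x hx hc y hy hcy hf with h3 | ⟨w, hw, hcl', hne, h3⟩
      · obtain ⟨w, hw, hcw, hp, hE, h3⟩ := h.separated x hx hc y hy hcy h3
        exact ⟨w, hw, hcw, hp.mono (by omega), hold w hp hE, h3⟩
      · exact ⟨w, hw, hcl'.2.1, hcl'.handled, hnew w hcl' hne, h3⟩

/-- The solution is everything except the omitted set `E` and the cover vertices not guessed to be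
in it. Two vertices of `E` differ in class, two cover vertices are separated by the labels or inside
the cover, and mixed pairs are settled by the demands of the guess. -/
theorem Realizes.exists_locDom {E : Finset ℕ} {j q k : ℕ} {f : ℕ → ℕ} (h : G.Realizes g E j q f)
    (ha : G.Accepts g k q f) : ∃ S, S.card = k ∧ G.LocDom S := by
  classical
  obtain ⟨hk, h1, h2⟩ := ha
  set D := (Finset.range G.n).filter fun x => G.cover x ∧ g x ≠ 1 with hD
  have hsub : D ∪ E ⊆ Finset.range G.n := by
    refine Finset.union_subset (Finset.filter_subset _ _) fun e he => ?_
    exact Finset.mem_range.2 (h.lt e he)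
  have hdisj : Disjoint D E := by
    rw [Finset.disjoint_left]
    intro x hx hE
    exact h.not_cover x hE (Finset.mem_filter.1 hx).2.1
  have hS : ∀ v, v ∈ Finset.range G.n \ (D ∪ E) ↔ v < G.n ∧ (G.cover v → g v = 1) ∧ v ∉ E := by
    intro v
    simp only [hD, Finset.mem_sdiff, Finset.mem_range, Finset.mem_union, Finset.mem_filter]
    tauto
  have hnS : ∀ v < G.n, v ∉ Finset.range G.n \ (D ∪ E) → (G.cover v ∧ g v ≠ 1) ∨ v ∈ E := by
    intro v hv hvS
    rw [hS] at hvS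
    tauto
  have hSc : ∀ w < G.n, G.cover w → g w = 1 → w ∈ Finset.range G.n \ (D ∪ E) :=
    fun w hw hc hg => (hS w).2 ⟨hw, fun _ => hg, fun hE => h.not_cover w hE hc⟩
  have hSi : ∀ w < G.n, ¬ G.cover w → w ∉ E → w ∈ Finset.range G.n \ (D ∪ E) :=
    fun w hw hc hE => (hS w).2 ⟨hw, fun h => absurd h hc, hE⟩
  have hns : ∀ u v, ¬ G.Same g u v →
      ∃ w ∈ Finset.range G.n \ (D ∪ E), ¬ (G.adj u w ↔ G.adj v w) := by
    intro u v huv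
    simp only [Same, not_forall] at huv
    obtain ⟨w, hw, hc, hg, huv⟩ := huv
    exact ⟨w, hSc w hw hc hg, huv⟩
  -- If `u` and `v` look the same inside the cover, then `u` was demanded to have a solution
  -- neighbour outside the cover, and `v` has no neighbour there at all.
  have hmix : ∀ u < G.n, ∀ v ∈ E, G.cover u → g u ≠ 1 →
      ∃ w ∈ Finset.range G.n \ (D ∪ E), ¬ (G.adj u w ↔ G.adj v w) := by
    intro u hu v hv hc hg
    by_cases hs : G.Same g u v
    · obtain ⟨w, hw, hcw, -, hE, hwu⟩ :=
        h.touched u hu hc ((h1 u hu hc hg).2 ((h.omittable v hv).2 u hu hc hg hs))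
      refine ⟨w, hSi w hw hcw hE, fun hiff => ?_⟩
      exact not_adj (h.not_cover v hv) hcw (hiff.1 (G.adj_symm hwu))
    · exact hns u v hs
  refine ⟨Finset.range G.n \ (D ∪ E), ?_, fun v hv => ((hS v).1 hv).1, fun v hv => ?_,
    fun u hu v hv huS hvS huv => ?_⟩
  · rw [Finset.card_sdiff_of_subset hsub, Finset.card_union_of_disjoint hdisj, Finset.card_range,
      h.card]
    omega
  · by_cases hvS : v ∈ Finset.range G.n \ (D ∪ E)
    · exact .inl hvS
    · refine .inr ?_
      rcases hnS v hv hvS with ⟨hc, hg⟩ | hE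
      · rcases (h1 v hv hc hg).1 with h3 | ⟨w, hw, hcw, hgw, h3⟩
        · obtain ⟨w, hw, hcw, -, hE, h4⟩ := h.touched v hv hc h3
          exact ⟨w, hSi w hw hcw hE, G.adj_symm h4⟩
        · exact ⟨w, hSc w hw hcw hgw, h3⟩
      · obtain ⟨w, hw, hcw, hgw, h3⟩ := (h.omittable v hE).1
        exact ⟨w, hSc w hw hcw hgw, h3⟩
  · rcases hnS u hu huS with ⟨hcu, hgu⟩ | hEu <;> rcases hnS v hv hvS with ⟨hcv, hgv⟩ | hEv
    · rcases h2 u hu hcu hgu v hv hcv hgv huv with h3 | h3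
      · obtain ⟨w, hw, hcw, -, hE, h4⟩ := h.separated u hu hcu v hv hcv h3
        refine ⟨w, hSi w hw hcw hE, fun hiff => h4 ⟨fun h => ?_, fun h => ?_⟩⟩
        · exact G.adj_symm (hiff.1 (G.adj_symm h))
        · exact G.adj_symm (hiff.2 (G.adj_symm h))
      · exact hns u v h3
    · exact hmix u hu v hEv hcu hgu
    · obtain ⟨w, hw, h3⟩ := hmix v hv u hEu hcv hgv
      exact ⟨w, hw, fun h => h3 h.symm⟩
    · exact hns u v fun hs => huv (h.unique u hEu v hEv hs)

/-! ### Completeness: from a solution to a run of the dynamic program -/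

variable (G) in
open Classical in
/-- The guess that describes a locating-dominating set. -/
noncomputable def guess (S : Finset ℕ) (x : ℕ) : ℕ :=
  if x ∈ S then 1 else if ∃ w ∈ S, ¬ G.cover w ∧ G.adj w x then 2 else 0

variable (G g) in
open Classical in
/-- The handled neighbours of `x` in the solution outside the cover. -/
noncomputable def trace (S : Finset ℕ) (j x : ℕ) : Finset ℕ :=
  S.filter fun w => ¬ G.cover w ∧ G.Handled g j w ∧ G.adj w x

variable (G g) in
open Classical in
noncomputable def omitted (S : Finset ℕ) (j : ℕ) : Finset ℕ :=
  (Finset.range G.n).filter fun v => ¬ G.cover v ∧ v ∉ S ∧ G.Handled g j v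

variable (G g) in
/-- The labelling describes the traces of the vertices of the cover. -/
structure Describes (S : Finset ℕ) (j : ℕ) (f : ℕ → ℕ) : Prop where
  zero : ∀ x < G.n, G.cover x → (f x = 0 ↔ G.trace g S j x = ∅)
  eq : ∀ x < G.n, G.cover x → ∀ y < G.n, G.cover y →
    (f x = f y ↔ G.trace g S j x = G.trace g S j y)

theorem mem_trace {S : Finset ℕ} {j x w : ℕ} : w ∈ G.trace g S j x ↔
    w ∈ S ∧ ¬ G.cover w ∧ G.Handled g j w ∧ G.adj w x := by
  simp [trace]

theorem mem_omitted {S : Finset ℕ} {j v : ℕ} : v ∈ G.omitted g S j ↔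
    v < G.n ∧ ¬ G.cover v ∧ v ∉ S ∧ G.Handled g j v := by
  simp [omitted]

theorem eq_one_iff {S : Finset ℕ} {x : ℕ} (hg : ∀ x < G.n, G.cover x → g x = G.guess S x)
    (hx : x < G.n) (hc : G.cover x) : g x = 1 ↔ x ∈ S := by
  rw [hg x hx hc, guess]
  split_ifs <;> simp_all

theorem eq_two_iff {S : Finset ℕ} {x : ℕ} (hg : ∀ x < G.n, G.cover x → g x = G.guess S x)
    (hx : x < G.n) (hc : G.cover x) :
    g x = 2 ↔ x ∉ S ∧ ∃ w ∈ S, ¬ G.cover w ∧ G.adj w x := by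
  rw [hg x hx hc, guess]
  split_ifs <;> simp_all

theorem LocDom.same_iff {S : Finset ℕ} {u v : ℕ} (hS : G.LocDom S)
    (hg : ∀ x < G.n, G.cover x → g x = G.guess S x) :
    G.Same g u v ↔ ∀ w ∈ S, G.cover w → (G.adj u w ↔ G.adj v w) :=
  ⟨fun h w hw hc => h w (hS.lt w hw) hc ((eq_one_iff hg (hS.lt w hw) hc).2 hw),
    fun h w hw hc h1 => h w ((eq_one_iff hg hw hc).1 h1) hc⟩

/-- Outside the cover the vertices are independent, so two omitted ones can be distinguished only by
solution vertices inside the cover. -/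
theorem LocDom.unique {S : Finset ℕ} {u v : ℕ} (hS : G.LocDom S)
    (hg : ∀ x < G.n, G.cover x → g x = G.guess S x)
    (hu : u < G.n) (hv : v < G.n) (huS : u ∉ S) (hvS : v ∉ S)
    (hcu : ¬ G.cover u) (hcv : ¬ G.cover v) (h : G.Same g u v) : u = v := by
  by_contra huv
  obtain ⟨w, hw, h'⟩ := hS.loc u hu v hv huS hvS huv
  by_cases hc : G.cover w
  · exact h' ((hS.same_iff hg).1 h w hw hc)
  · exact h' (iff_of_false (not_adj hcu hc) (not_adj hcv hc))

/-- The dominator of `v` must lie in the cover. A cover vertex outside `S` that looks like `v` there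
must be distinguished from it by some `w ∈ S` outside the cover, and this `w` is a neighbour of the
cover vertex only. -/
theorem LocDom.omittable {S : Finset ℕ} {v : ℕ} (hS : G.LocDom S)
    (hg : ∀ x < G.n, G.cover x → g x = G.guess S x)
    (hv : v < G.n) (hvS : v ∉ S) (hcv : ¬ G.cover v) :
    G.Omittable g v := by
  constructor
  · obtain ⟨w, hw, h⟩ := (hS.dom v hv).resolve_left hvS
    have hc := (G.isCover h).resolve_left hcv
    exact ⟨w, hS.lt w hw, hc, (eq_one_iff hg (hS.lt w hw) hc).2 hw, h⟩
  · intro x hx hc hx1 hs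
    rw [Ne, eq_one_iff hg hx hc] at hx1
    refine (eq_two_iff hg hx hc).2 ⟨hx1, ?_⟩
    obtain ⟨w, hw, h⟩ := hS.loc x hx v hv hx1 hvS (fun h => hcv (h ▸ hc))
    have hcw : ¬ G.cover w := fun hcw => h ((hS.same_iff hg).1 hs w hw hcw)
    have := not_adj hcv hcw
    exact ⟨w, hw, hcw, G.adj_symm (by tauto)⟩

theorem LocDom.step {S : Finset ℕ} {j : ℕ} {f f' : ℕ → ℕ} (hS : G.LocDom S)
    (hg : ∀ x < G.n, G.cover x → g x = G.guess S x) (hf : G.Describes g S j f)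
    (hf' : G.Describes g S (j + 1) f') :
    G.Step g j (G.omitted g S j).card f (G.omitted g S (j + 1)).card f' := by
  classical
  -- Any `e` outside `S` works for the labels: what is new in the traces comes from the class of `j`
  -- within `S`.
  have main : ∀ e, (∀ w ∈ S, w ≠ e) →
      (∀ x < G.n, G.cover x → f' x ≠ 0 →
        f x ≠ 0 ∨ ∃ w < G.n, G.InClass g j w ∧ w ≠ e ∧ G.adj w x) ∧
      ∀ x < G.n, G.cover x → ∀ y < G.n, G.cover y → f' x ≠ f' y →
        f x ≠ f y ∨ ∃ w < G.n, G.InClass g j w ∧ w ≠ e ∧ ¬ (G.adj w x ↔ G.adj w y) := by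
    intro e he
    refine ⟨fun x hx hc h => ?_, fun x hx hc y hy hcy h => ?_⟩
    · rw [Ne, hf'.zero x hx hc, ← Ne, ← Finset.nonempty_iff_ne_empty] at h
      obtain ⟨w, hw⟩ := h
      obtain ⟨hwS, hcw, hp, hadj⟩ := mem_trace.1 hw
      rcases hp.of_succ (hS.lt w hwS) hcw with hp | hcl
      · refine .inl fun h0 => ?_
        have : w ∈ G.trace g S j x := mem_trace.2 ⟨hwS, hcw, hp, hadj⟩
        rw [(hf.zero x hx hc).1 h0] at this
        simp at this
      · exact .inr ⟨w, hS.lt w hwS, hcl, he w hwS, hadj⟩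
    · by_contra! hcon
      obtain ⟨h1, h2⟩ := hcon
      rw [hf.eq x hx hc y hy hcy, Finset.ext_iff] at h1
      refine h ((hf'.eq x hx hc y hy hcy).2 (Finset.ext fun w => ?_))
      have h1 := h1 w
      rw [mem_trace, mem_trace] at h1 ⊢
      refine and_congr_right fun hwS => and_congr_right fun hcw => and_congr_right fun hp => ?_
      rcases hp.of_succ (hS.lt w hwS) hcw with hp | hcl
      · simpa [hwS, hcw, hp] using h1
      · exact h2 w (hS.lt w hwS) hcl (he w hwS)
  by_cases hex : ∃ e, G.InClass g j e ∧ e ∉ S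
  · obtain ⟨e, hcl, heS⟩ := hex
    refine ⟨e, hcl.1.le, .inr ⟨?_, hcl, hS.omittable hg hcl.1 heS hcl.2.1⟩,
      main e fun w hw h => heS (h ▸ hw)⟩
    have hnot : e ∉ G.omitted g S j := fun h => hcl.not_handled (mem_omitted.1 h).2.2.2
    rw [← Finset.card_insert_of_notMem hnot]
    congr 1
    ext v
    rw [Finset.mem_insert, mem_omitted, mem_omitted]
    constructor
    · rintro ⟨hv, hc, hvS, hp⟩
      rcases hp.of_succ hv hc with hp | hcl'
      · exact .inr ⟨hv, hc, hvS, hp⟩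
      · exact .inl (hS.unique hg hv hcl.1 hvS heS hc hcl.2.1 (hcl'.2.2.1.trans hcl.2.2.1.symm))
    · rintro (rfl | ⟨hv, hc, hvS, hp⟩)
      · exact ⟨hcl.1, hcl.2.1, heS, hcl.handled⟩
      · exact ⟨hv, hc, hvS, hp.mono (by omega)⟩
  · refine ⟨G.n, le_rfl, .inl ⟨rfl, ?_⟩, main G.n fun w hw h => (hS.lt w hw).ne h⟩
    congr 1
    ext v
    rw [mem_omitted, mem_omitted]
    refine and_congr_right fun hv => and_congr_right fun hc => and_congr_right fun hvS => ?_
    refine ⟨fun hp => (hp.of_succ hv hc).resolve_right fun hcl => hex ⟨v, hcl, hvS⟩,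
      fun hp => hp.mono (by omega)⟩

theorem LocDom.accepts {S : Finset ℕ} {f : ℕ → ℕ} (hS : G.LocDom S)
    (hg : ∀ x < G.n, G.cover x → g x = G.guess S x) (hf : G.Describes g S G.n f) :
    G.Accepts g S.card (G.omitted g S G.n).card f := by
  classical
  have hp : ∀ w < G.n, G.Handled g G.n w := fun w hw => ⟨w, hw, Same.refl w⟩
  have htr : ∀ x < G.n, G.cover x → (∃ w ∈ S, ¬ G.cover w ∧ G.adj w x) → f x ≠ 0 := by
    rintro x hx hc ⟨w, hw, hcw, h⟩ h0
    have : w ∈ G.trace g S G.n x := mem_trace.2 ⟨hw, hcw, hp w (hS.lt w hw), h⟩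
    rw [(hf.zero x hx hc).1 h0] at this
    simp at this
  refine ⟨?_, fun x hx hc hx1 => ⟨?_, fun h2 => htr x hx hc ((eq_two_iff hg hx hc).1 h2).2⟩,
    fun x hx hc hx1 y hy hcy hy1 hxy => ?_⟩
  -- The complement of `S` is split into its parts inside and outside the cover.
  · have h1 : (Finset.range G.n).filter (fun x => G.cover x ∧ g x ≠ 1) =
        ((Finset.range G.n).filter fun x => x ∉ S).filter G.cover := by
      ext x
      simp only [Finset.mem_filter, Finset.mem_range]
      constructor
      · rintro ⟨hx, hc, h⟩
        exact ⟨⟨hx, fun h' => h ((eq_one_iff hg hx hc).2 h')⟩, hc⟩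
      · rintro ⟨⟨hx, h⟩, hc⟩
        exact ⟨hx, hc, fun h' => h ((eq_one_iff hg hx hc).1 h')⟩
    have h2 : G.omitted g S G.n =
        ((Finset.range G.n).filter fun x => x ∉ S).filter fun x => ¬ G.cover x := by
      ext x
      simp only [mem_omitted, Finset.mem_filter, Finset.mem_range]
      exact ⟨fun h => ⟨⟨h.1, h.2.2.1⟩, h.2.1⟩, fun h => ⟨h.1.1, h.2, h.1.2, hp x h.1.1⟩⟩
    have h3 : (Finset.range G.n).filter (fun x => x ∈ S) = S := by
      ext x
      simp only [Finset.mem_filter, Finset.mem_range]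
      exact ⟨fun h => h.2, fun h => ⟨hS.lt x h, h⟩⟩
    have h4 := Finset.card_filter_add_card_filter_not (s := Finset.range G.n) (fun x => x ∈ S)
    rw [h3, Finset.card_range] at h4
    rw [h1, h2, add_assoc, Finset.card_filter_add_card_filter_not, h4]
  · rw [Ne, eq_one_iff hg hx hc] at hx1
    obtain ⟨w, hw, h⟩ := (hS.dom x hx).resolve_left hx1
    by_cases hcw : G.cover w
    · exact .inr ⟨w, hS.lt w hw, hcw, (eq_one_iff hg (hS.lt w hw) hcw).2 hw, h⟩
    · exact .inl (htr x hx hc ⟨w, hw, hcw, G.adj_symm h⟩)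
  · rw [Ne, eq_one_iff hg hx hc] at hx1
    rw [Ne, eq_one_iff hg hy hcy] at hy1
    obtain ⟨w, hw, h⟩ := hS.loc x hx y hy hx1 hy1 hxy
    by_cases hcw : G.cover w
    · exact .inr fun hs => h ((hS.same_iff hg).1 hs w hw hcw)
    · refine .inl fun he => h ?_
      have := Finset.ext_iff.1 ((hf.eq x hx hc y hy hcy).1 he) w
      simp only [mem_trace, hw, hcw, hp w (hS.lt w hw), true_and, not_false_eq_true] at this
      exact ⟨fun h => G.adj_symm (this.1 (G.adj_symm h)),
        fun h => G.adj_symm (this.2 (G.adj_symm h))⟩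

end CoveredGraph

end LDS

namespace LDS

/-! ### States of the dynamic program as numbers -/

section

variable (G : CoveredGraph) [DecidablePred G.cover] (L : ℕ)

def guessOf (s : ℕ) : ℕ → ℕ := label (Nat.count G.cover G.n + 3) G.cover (s / L % L)
def labelOf (s : ℕ) : ℕ → ℕ := label (Nat.count G.cover G.n + 3) G.cover (s % L)
def omittedOf (s : ℕ) : ℕ := s / (L * L) % L
def indexOf (s : ℕ) : ℕ := s / (L * L * L)

/-- The state `s` can follow the state `y`. -/
def Follows (y s : ℕ) : Prop :=
  s / L % L = y / L % L ∧ indexOf L s = indexOf L y + 1 ∧ indexOf L y < G.n ∧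
    G.Step (guessOf G L y) (indexOf L y) (omittedOf L y) (labelOf G L y) (omittedOf L s)
      (labelOf G L s)

end

theorem decode {L c g q j : ℕ} (hc : c < L) (hg : g < L) (hq : q < L) :
    let s := c + L * (g + L * (q + L * j))
    s % L = c ∧ s / L % L = g ∧ s / (L * L) % L = q ∧ s / (L * L * L) = j := by
  have h1 : (c + L * (g + L * (q + L * j))) / L = g + L * (q + L * j) := by
    rw [Nat.add_mul_div_left _ _ (by omega), Nat.div_eq_of_lt hc, zero_add]
  have h2 : (g + L * (q + L * j)) / L = q + L * j := by
    rw [Nat.add_mul_div_left _ _ (by omega), Nat.div_eq_of_lt hg, zero_add]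
  have h3 : (q + L * j) / L = j := by
    rw [Nat.add_mul_div_left _ _ (by omega), Nat.div_eq_of_lt hq, zero_add]
  dsimp only
  simp only [← Nat.div_div_eq_div_mul, h1, h2, h3]
  rw [Nat.add_mul_mod_self_left,
    Nat.add_mul_mod_self_left, Nat.add_mul_mod_self_left]
  exact ⟨Nat.mod_eq_of_lt hc, Nat.mod_eq_of_lt hg, Nat.mod_eq_of_lt hq, trivial⟩

theorem code_lt {L c g q j : ℕ} (hc : c < L) (hg : g < L) (hq : q < L) (hj : j < L) :
    c + L * (g + L * (q + L * j)) < L * (L * (L * L)) := by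
  have key : ∀ {a b N : ℕ}, a < L → b < N → a + L * b < L * N := fun {a b N} ha hb => by
    calc a + L * b < L + L * b := by omega
      _ = L * (b + 1) := by ring
      _ ≤ L * N := by gcongr; omega
  exact key hc (key hg (key hq hj))

/-- The initial states have all labels, the number of omissions and the index equal to zero, with an
arbitrary guess; the guess is then carried along unchanged. The index is the leading digit, so each
transition increases the state. -/
theorem exists_locDom_iff_of_reachable {G : CoveredGraph} [DecidablePred G.cover] {k L : ℕ}
    {R : ℕ → Prop} (hL : (Nat.count G.cover G.n + 3) ^ Nat.count G.cover G.n ≤ L) (hn : G.n < L)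
    (hR : ∀ s < L * (L * (L * L)), R s ↔
      (s % L = 0 ∧ s / (L * L) = 0) ∨ ∃ y < s, R y ∧ Follows G L y s) :
    (∃ s < L * (L * (L * L)), R s ∧ indexOf L s = G.n ∧
      G.Accepts (guessOf G L s) k (omittedOf L s) (labelOf G L s)) ↔
    ∃ S : Finset ℕ, S.card = k ∧ G.LocDom S := by
  constructor
  · rintro ⟨s, hs, hRs, -, hacc⟩
    have H : ∀ s, s < L * (L * (L * L)) → R s → ∃ E,
        G.Realizes (guessOf G L s) E (indexOf L s) (omittedOf L s) (labelOf G L s) := by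
      intro s
      induction s using Nat.strong_induction_on with
      | _ s ih =>
        intro hs hRs
        rcases (hR s hs).1 hRs with ⟨h0, h1⟩ | ⟨y, hy, hRy, hg, hj, -, hst⟩
        · have h2 : indexOf L s = 0 := by
            rw [indexOf, ← Nat.div_div_eq_div_mul, h1, Nat.zero_div]
          have h3 : omittedOf L s = 0 := by rw [omittedOf, h1, Nat.zero_mod]
          rw [h2, h3]
          exact ⟨∅, .zero fun x => by simp [labelOf, label, h0]⟩
        · obtain ⟨E, hE⟩ := ih y hy (hy.trans hs) hRy
          rw [hj, guessOf, hg]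
          exact hE.step hst
    obtain ⟨E, hE⟩ := H s hs hRs
    exact hE.exists_locDom hacc
  · rintro ⟨S, hk, hS⟩
    have hL0 : 0 < L := by omega
    -- The base `r + 3`, with `r` the size of the cover, leaves room both for the guesses `0, 1, 2`
    -- and for labels up to `r`.
    obtain ⟨gc, hgc, hg⟩ := exists_digits (Nat.count G.cover G.n + 3) G.n G.cover (G.guess S)
      fun x _ _ => by
        rw [CoveredGraph.guess]
        split_ifs <;> omega
    set g := label (Nat.count G.cover G.n + 3) G.cover gc with hgdef
    replace hg : ∀ x < G.n, G.cover x → g x = G.guess S x := hg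
    have hq : ∀ j, (G.omitted g S j).card < L := fun j => by
      refine lt_of_le_of_lt (Finset.card_le_card (t := Finset.range G.n) fun v hv => ?_) (by simpa)
      exact Finset.mem_range.2 (CoveredGraph.mem_omitted.1 hv).1
    have H : ∀ j ≤ G.n, ∃ c < L, G.Describes g S j
        (label (Nat.count G.cover G.n + 3) G.cover c) ∧
        R (c + L * (gc + L * ((G.omitted g S j).card + L * j))) := by
      intro j
      induction j with
      | zero =>
        intro _
        have hproc : ∀ v, ¬ G.Handled g 0 v := fun v => by simp [CoveredGraph.Handled]
        have h1 : ∀ x, G.trace g S 0 x = ∅ := fun x => by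
          ext w
          simp [CoveredGraph.mem_trace, hproc]
        have h2 : G.omitted g S 0 = ∅ := by
          ext w
          simp [CoveredGraph.mem_omitted, hproc]
        refine ⟨0, hL0, ⟨fun x _ _ => by simp [label, h1], fun x _ _ y _ _ => by simp [label, h1]⟩,
          (hR _ (code_lt hL0 (by omega) (hq 0) hL0)).2 (.inl ⟨?_, ?_⟩)⟩
        · exact (decode hL0 (by omega) (hq 0)).1
        · rw [← Nat.div_div_eq_div_mul]
          rw [h2, Finset.card_empty, mul_zero, add_zero, mul_zero, add_zero, zero_add,
            Nat.mul_div_cancel_left _ hL0]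
          exact Nat.div_eq_of_lt (by omega)
      | succ j ih =>
        intro hj
        obtain ⟨c, hc, hd, hRc⟩ := ih (by omega)
        obtain ⟨c', hc', hd0, hd1⟩ := exists_label_code
          (B := Nat.count G.cover G.n + 3) (n := G.n) (X := G.cover) (by omega)
          (G.trace g S (j + 1)) ∅
        replace hc' : c' < L := by omega
        have hlt := code_lt hc' (show gc < L by omega) (hq (j + 1)) (show j + 1 < L by omega)
        obtain ⟨d1, d2, d3, d4⟩ := decode (j := j) hc (show gc < L by omega) (hq j)
        obtain ⟨e1, e2, e3, e4⟩ := decode (j := j + 1) hc' (show gc < L by omega) (hq (j + 1))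
        refine ⟨c', hc', ⟨hd0, hd1⟩, (hR _ hlt).2 (.inr ⟨_, ?_, hRc, ?_⟩)⟩
        · by_contra! h
          have := Nat.div_le_div_right (c := L * L * L) h
          omega
        · refine ⟨e2.trans d2.symm, ?_, ?_, ?_⟩
          · rw [indexOf, indexOf, d4, e4]
          · rw [indexOf, d4]
            omega
          · rw [guessOf, labelOf, labelOf, indexOf, omittedOf, omittedOf, d1, d2, d3, d4, e1, e3]
            exact hS.step hg hd ⟨hd0, hd1⟩
    obtain ⟨c, hc, hd, hRc⟩ := H G.n le_rfl
    obtain ⟨d1, d2, d3, d4⟩ := decode (j := G.n) hc (show gc < L by omega) (hq G.n)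
    refine ⟨_, code_lt hc (by omega) (hq G.n) hn, hRc, d4, ?_⟩
    rw [guessOf, labelOf, omittedOf, d1, d2, d3, ← hk]
    exact hS.accepts hg hd

/-! ### A vertex cover from a maximal matching -/

/-- The sum selects the least number with the property `p`, increased by one. -/
theorem sum_least (n : ℕ) (p : ℕ → Prop) [DecidablePred p] :
    ((∑ w ∈ Finset.range n, if p w ∧ ∀ i < w, ¬ p i then w + 1 else 0) = 0 ∧ ∀ w < n, ¬ p w) ∨
    ∃ w < n, p w ∧ (∑ w ∈ Finset.range n, if p w ∧ ∀ i < w, ¬ p i then w + 1 else 0) = w + 1 := by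
  by_cases h : ∃ w, w < n ∧ p w
  · have h' : ∃ w, p w := h.imp fun _ h => h.2
    refine .inr ⟨Nat.find h', ?_, Nat.find_spec h', ?_⟩
    · obtain ⟨w, hw, hp⟩ := h
      exact (Nat.find_min' h' hp).trans_lt hw
    · rw [Finset.sum_eq_single (Nat.find h')]
      · rw [if_pos ⟨Nat.find_spec h', fun i hi => Nat.find_min h' hi⟩]
      · intro b _ hb
        rw [if_neg]
        rintro ⟨hp, hmin⟩
        exact hb (le_antisymm (not_lt.1 fun hlt => hmin _ hlt (Nat.find_spec h'))
          (Nat.find_min' h' hp))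
      · intro hn
        obtain ⟨w, hw, hp⟩ := h
        exact absurd (Finset.mem_range.2 ((Nat.find_min' h' hp).trans_lt hw)) hn
  · push Not at h
    refine .inl ⟨Finset.sum_eq_zero fun w hw => ?_, h⟩
    rw [if_neg fun hp => h w (Finset.mem_range.1 hw) hp.1]

/-- `M` describes a greedy matching: `M v = w + 1` if `v < w` is an edge of the matching. -/
structure GreedyMatching (n : ℕ) (adj : ℕ → ℕ → Prop) (M : ℕ → ℕ) : Prop where
  spec : ∀ v < n, (M v = 0 ∧ ∀ w < n,
      ¬ (v < w ∧ adj v w ∧ ∀ u < v, M u ≠ w + 1 ∧ M u ≠ v + 1)) ∨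
    ∃ w < n, (v < w ∧ adj v w ∧ ∀ u < v, M u ≠ w + 1 ∧ M u ≠ v + 1) ∧ M v = w + 1

def matched (n : ℕ) (M : ℕ → ℕ) (v : ℕ) : Prop := v < n ∧ (M v ≠ 0 ∨ ∃ u < n, M u = v + 1)

variable {n : ℕ} {adj : ℕ → ℕ → Prop} {M : ℕ → ℕ}

theorem GreedyMatching.of_eq_succ (h : GreedyMatching n adj M) {v w : ℕ} (hv : v < n)
    (hM : M v = w + 1) : v < w ∧ adj v w ∧ ∀ u < v, M u ≠ w + 1 ∧ M u ≠ v + 1 := by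
  rcases h.spec v hv with ⟨h0, -⟩ | ⟨w', -, h', hM'⟩
  · omega
  · obtain rfl : w = w' := by omega
    exact h'

/-- If both ends of an edge `u < v` were unmatched, `v` would have been available when `u` was
treated. -/
theorem GreedyMatching.isCover (h : GreedyMatching n adj M) {u v : ℕ} (hu : u < n) (hv : v < n)
    (huv : u < v) (hadj : adj u v) : matched n M u ∨ matched n M v := by
  by_contra! hcon
  obtain ⟨h1, h2⟩ := hcon
  simp only [matched, not_and, not_or, not_exists] at h1 h2
  rcases h.spec u hu with ⟨h0, h'⟩ | ⟨w, -, -, h'⟩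
  · exact h' v hv ⟨huv, hadj, fun i hi =>
      ⟨(h2 hv).2 i (by omega), (h1 hu).2 i (by omega)⟩⟩
  · have := (h1 hu).1
    omega

open Classical in
-- The edges of a matching are disjoint, so a vertex cover `C` contains a different vertex for each
-- of them. The set `A` of smaller endpoints counts the edges.
theorem GreedyMatching.count_le (h : GreedyMatching n adj M) (C : Finset ℕ)
    (hC : ∀ u v, adj u v → u ∈ C ∨ v ∈ C) : Nat.count (matched n M) n ≤ 2 * C.card := by
  set A := (Finset.range n).filter fun v => M v ≠ 0 with hA
  have hmemA : ∀ v, v ∈ A ↔ v < n ∧ M v ≠ 0 := fun v => by simp [hA]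
  have h1 : Nat.count (matched n M) n ≤ 2 * A.card := by
    rw [Nat.count_eq_card_filter_range]
    calc _ ≤ (A ∪ A.image fun v => M v - 1).card := by
          refine Finset.card_le_card fun v hv => ?_
          obtain ⟨hvn, -, hv⟩ := (Finset.mem_filter.1 hv)
          rcases hv with hv | ⟨u, hu, hv⟩
          · exact Finset.mem_union_left _ ((hmemA v).2 ⟨Finset.mem_range.1 hvn, hv⟩)
          · exact Finset.mem_union_right _
              (Finset.mem_image.2 ⟨u, (hmemA u).2 ⟨hu, by omega⟩, by omega⟩)
      _ ≤ A.card + A.card := (Finset.card_union_le _ _).trans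
          (Nat.add_le_add_left Finset.card_image_le _)
      _ = _ := by ring
  have h2 : A.card ≤ C.card := by
    have hM : ∀ v ∈ A, M v = (M v - 1) + 1 := fun v hv => by
      have := ((hmemA v).1 hv).2
      omega
    refine Finset.card_le_card_of_injOn (fun v => if v ∈ C then v else M v - 1) ?_ ?_
    · intro v hv
      have := (hC _ _ (h.of_eq_succ ((hmemA v).1 hv).1 (hM v hv)).2.1)
      dsimp only
      split_ifs with hvC
      · exact hvC
      · exact this.resolve_left hvC
    -- A smaller endpoint of one edge is never the larger endpoint of another; `key2` says that
    -- larger endpoints are distinct.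
    · have key1 : ∀ v ∈ A, ∀ v' ∈ A, v ≠ M v' - 1 := fun v hv v' hv' heq => by
        obtain ⟨hlt, -, -⟩ := h.of_eq_succ ((hmemA v').1 hv').1 (hM v' hv')
        have h3 := (h.of_eq_succ ((hmemA v).1 hv).1 (hM v hv)).2.2 v' (by omega)
        have := hM v' hv'
        omega
      have key2 : ∀ v ∈ A, ∀ v' ∈ A, v < v' → M v ≠ M v' := fun v hv v' hv' hlt heq => by
        have h3 := (h.of_eq_succ ((hmemA v').1 hv').1 (hM v' hv')).2.2 v hlt
        have := hM v' hv'
        omega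
      intro v hv v' hv' heq
      have hv1 := hM v hv
      have hv1' := hM v' hv'
      dsimp only at heq
      split_ifs at heq
      · exact heq
      · exact absurd heq (key1 v hv v' hv')
      · exact absurd heq.symm (key1 v' hv' v hv)
      · rcases lt_trichotomy v v' with hlt | rfl | hlt
        · exact absurd (by omega) (key2 v hv v' hv' hlt)
        · rfl
        · exact absurd (by omega) (key2 v' hv' v hv hlt)
  omega

end LDS

/-! ## The program for Locating-Dominating Set -/

namespace RAM.Term

def iff (a b : Term) : Term := ite a b (not b)

@[simp] theorem holds_iff_term {a b : Term} {m : Mem} :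
    (iff a b).Holds m ↔ (a.Holds m ↔ b.Holds m) := by
  have : (iff a b).Holds m ↔ if a.Holds m then b.Holds m else ¬ b.Holds m := by
    rw [Holds, iff, eval_ite]
    split_ifs with h
    · rfl
    · exact holds_not
  rw [this]
  split_ifs with h <;> simp [h]

end RAM.Term

namespace RAM.LocDom

open Term LDS

def order : Term := get 0 (const 0)
def size : Term := get 0 (const 1)
-- The range checks exclude reads outside the matrix, so that `Ready.holds_adj` holds for arbitrary
-- values of the two terms.
def adj (u v : Term) : Term :=
  and (lt u order) (and (lt v order) (get 0 (add (const 2) (add (mul u order) v))))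
def exV (x : ℕ) (a : Term) : Term := ex x (and (lt (var x) order) a)
def allV (x : ℕ) (a : Term) : Term := all x (imp (lt (var x) order) a)
def cov (x : Term) : Term := get 4 x
def radix : Term := add (get 1 order) (add order (const 1))
def guessLabel (s x : Term) : Term := Term.label (mod (div s radix) radix) x
def stateLabel (s x : Term) : Term := Term.label (mod s radix) x
def omitCount (s : Term) : Term := mod (div s (mul radix radix)) radix
def index (s : Term) : Term := div s (mul (mul radix radix) radix)
def inSol (s x : Term) : Term := and (cov x) (eq (guessLabel s x) (const 1))
def notInSol (s x : Term) : Term := and (cov x) (not (eq (guessLabel s x) (const 1)))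
def demanded (s x : Term) : Term := and (cov x) (eq (guessLabel s x) (const 2))
def touched (s x : Term) : Term := and (cov x) (not (eq (stateLabel s x) (const 0)))
def separated (s x y : Term) : Term :=
  and (cov x) (and (cov y) (not (eq (stateLabel s x) (stateLabel s y))))

/-- Bound variables are chosen by hand to avoid capture: `7` here, `6` and `7` in `inClass`. The
arguments must not depend on these. -/
def same (s u v : Term) : Term :=
  allV 7 (imp (inSol s (var 7)) (iff (adj u (var 7)) (adj v (var 7))))
def inClass (s v : Term) : Term :=
  and (lt v order) <| and (not (cov v)) <| and (same s v (index s)) <|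
    allV 6 (imp (lt (var 6) (index s)) (not (same s (var 6) (index s))))
def omittable (s v : Term) : Term :=
  and (exV 5 (and (inSol s (var 5)) (adj v (var 5))))
    (allV 3 (imp (notInSol s (var 3)) (imp (same s (var 3) v) (demanded s (var 3)))))

/-- The state `0` can follow the state `1`. -/
def follows : Term :=
  and (eq (mod (div (var 0) radix) radix) (mod (div (var 1) radix) radix)) <|
  and (eq (index (var 0)) (add (index (var 1)) (const 1))) <|
  and (lt (index (var 1)) order) <|
  -- The range includes `order`, which encodes that no vertex is omitted.
  ex 2 <| and (lt (var 2) (add order (const 1))) <|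
  and (or (and (eq (var 2) order) (eq (omitCount (var 0)) (omitCount (var 1))))
    (and (eq (omitCount (var 0)) (add (omitCount (var 1)) (const 1)))
      (and (inClass (var 1) (var 2)) (omittable (var 1) (var 2))))) <|
  and
    (allV 3 (imp (touched (var 0) (var 3)) (or (touched (var 1) (var 3))
      (exV 5 (and (inClass (var 1) (var 5))
        (and (not (eq (var 5) (var 2))) (adj (var 5) (var 3))))))))
    (allV 3 (allV 4 (imp (separated (var 0) (var 3) (var 4))
      (or (separated (var 1) (var 3) (var 4))
        (exV 5 (and (inClass (var 1) (var 5)) (and (not (eq (var 5) (var 2)))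
          (not (iff (adj (var 5) (var 3)) (adj (var 5) (var 4)))))))))))

def reachable : Term :=
  or (and (eq (mod (var 0) radix) (const 0)) (eq (div (var 0) (mul radix radix)) (const 0))) <|
    ex 1 <| and (lt (var 1) (var 0)) <| and (get 3 (var 1)) follows

def accepts : Term :=
  and (eq (add (add size (count 3 (and (lt (var 3) order) (notInSol (var 0) (var 3)))))
    (omitCount (var 0))) order) <|
  and (allV 3 (imp (notInSol (var 0) (var 3))
    (and (or (touched (var 0) (var 3)) (exV 5 (and (inSol (var 0) (var 5)) (adj (var 3) (var 5)))))
      (imp (demanded (var 0) (var 3)) (touched (var 0) (var 3)))))) <|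
  allV 3 (imp (notInSol (var 0) (var 3)) (allV 4 (imp (notInSol (var 0) (var 4))
    (imp (not (eq (var 3) (var 4)))
      (or (separated (var 0) (var 3) (var 4)) (not (same (var 0) (var 3) (var 4))))))))

def answer : Term :=
  ex 0 <| and (get 3 (var 0)) <| and (eq (index (var 0)) order) accepts

/-- The memory before the dynamic programming table is filled. -/
structure Ready (G : CoveredGraph) [DecidablePred G.cover] (k L : ℕ) (M : Mem) : Prop where
  lim : M.lim = L * (L * (L * L))
  order : M.arr 0 0 = G.n
  size : M.arr 0 1 = k
  adj : ∀ u < G.n, ∀ v < G.n, M.arr 0 (2 + (u * G.n + v)) ≠ 0 ↔ G.adj u v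
  cover : ∀ v, M.arr 4 v ≠ 0 ↔ G.cover v
  cover_lt : ∀ v, G.cover v → v < G.n
  pow : ∀ x ≤ G.n, M.arr 1 x = (Nat.count G.cover G.n + 3) ^ Nat.count G.cover x
  base : M.arr 2 0 = Nat.count G.cover G.n + 3
  radix : L = (Nat.count G.cover G.n + 3) ^ Nat.count G.cover G.n + (G.n + 1)

/-! ### Meaning of the terms for Locating-Dominating Set -/

section

variable {G : CoveredGraph} [DecidablePred G.cover] {k L : ℕ} {M : Mem}

theorem ready_bind_iff {x v : ℕ} : Ready G k L (M.bind x v) ↔ Ready G k L M :=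
  ⟨fun h => ⟨h.lim, h.order, h.size, h.adj, h.cover, h.cover_lt, h.pow, h.base, h.radix⟩,
    fun h => ⟨h.lim, h.order, h.size, h.adj, h.cover, h.cover_lt, h.pow, h.base, h.radix⟩⟩

theorem Ready.of_eq {M' : Mem} (h : Ready G k L M) (hl : M'.lim = M.lim)
    (ha : ∀ B ≠ 3, M'.arr B = M.arr B) : Ready G k L M' where
  lim := hl.trans h.lim
  order := by rw [ha 0 (by simp), h.order]
  size := by rw [ha 0 (by simp), h.size]
  adj := by rw [ha 0 (by simp)]; exact h.adj
  cover := by rw [ha 4 (by simp)]; exact h.cover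
  cover_lt := h.cover_lt
  pow := by rw [ha 1 (by simp)]; exact h.pow
  base := by rw [ha 2 (by simp), h.base]
  radix := h.radix

theorem Ready.le_lim (h : Ready G k L M) : G.n < M.lim ∧ L ≤ M.lim ∧ L * L ≤ M.lim := by
  have h1 := h.radix
  have h2 := h.lim
  have h3 : L ≤ L * L := Nat.le_mul_self L
  have h4 : L * L ≤ (L * L) * (L * L) := Nat.le_mul_self _
  rw [mul_assoc] at h4
  omega

theorem Ready.eval_order (h : Ready G k L M) : LocDom.order.eval M = G.n := h.order

theorem Ready.eval_radix (h : Ready G k L M) : LocDom.radix.eval M = L := by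
  simp [LocDom.radix, h.eval_order, h.pow, ← h.radix]

theorem Ready.holds_exV (h : Ready G k L M) {x : ℕ} {a : Term} :
    (exV x a).Holds M ↔ ∃ i < G.n, a.Holds (M.bind x i) := by
  have := h.le_lim
  have h' := fun i => (ready_bind_iff (x := x) (v := i)).2 h
  simp only [exV, holds_ex, holds_and, holds_lt, eval_var, Mem.bind_env, if_true,
    (h' _).eval_order]
  exact exists_congr fun i => ⟨fun h => h.2, fun h => ⟨by omega, h⟩⟩

theorem Ready.holds_allV (h : Ready G k L M) {x : ℕ} {a : Term} :
    (allV x a).Holds M ↔ ∀ i < G.n, a.Holds (M.bind x i) := by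
  have := h.le_lim
  have h' := fun i => (ready_bind_iff (x := x) (v := i)).2 h
  simp only [allV, holds_all, holds_imp, holds_lt, eval_var, Mem.bind_env, if_true,
    (h' _).eval_order]
  exact forall_congr' fun i => ⟨fun h hi => h (by omega) hi, fun h _ hi => h hi⟩

theorem Ready.holds_cov (h : Ready G k L M) {x : Term} :
    (cov x).Holds M ↔ G.cover (x.eval M) := h.cover _

theorem Ready.holds_adj (h : Ready G k L M) {u v : Term} :
    (LocDom.adj u v).Holds M ↔ G.adj (u.eval M) (v.eval M) := by
  have := h.le_lim
  simp only [LocDom.adj, holds_and, holds_lt, h.eval_order, holds_get, eval_add, eval_const,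
    eval_mul]
  constructor
  · rintro ⟨hu, hv, h1⟩
    rw [min_eq_left (by omega)] at h1
    exact (h.adj _ hu _ hv).1 h1
  · intro h1
    obtain ⟨hu, hv⟩ := G.adj_lt h1
    refine ⟨hu, hv, ?_⟩
    rw [min_eq_left (by omega)]
    exact (h.adj _ hu _ hv).2 h1

variable {s x y : Term}

theorem Ready.eval_guessCode (h : Ready G k L M) (hs : s.eval M < L * (L * (L * L))) :
    (mod (div s LocDom.radix) LocDom.radix).eval M = s.eval M / L % L := by
  have hs' : s.eval M ≤ M.lim := by rw [h.lim]; exact hs.le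
  rw [eval_mod_of_le, eval_div_of_le hs', h.eval_radix]
  rw [eval_div_of_le hs']
  exact (Nat.div_le_self _ _).trans hs'

theorem Ready.eval_labelCode (h : Ready G k L M) (hs : s.eval M < L * (L * (L * L))) :
    (mod s LocDom.radix).eval M = s.eval M % L := by
  rw [eval_mod_of_le (by rw [h.lim]; exact hs.le), h.eval_radix]

theorem Ready.eval_guessLabel (h : Ready G k L M) (hs : s.eval M < L * (L * (L * L)))
    (hx : G.cover (x.eval M)) :
    (guessLabel s x).eval M = guessOf G L (s.eval M) (x.eval M) := by
  have h1 := h.eval_guessCode hs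
  rw [guessLabel, Term.eval_label, h1, h.pow _ (h.cover_lt _ hx).le, h.base]
  · rfl
  · rw [h1, h.lim]
    exact ((Nat.mod_le _ _).trans (Nat.div_le_self _ _)).trans hs.le

theorem Ready.eval_stateLabel (h : Ready G k L M) (hs : s.eval M < L * (L * (L * L)))
    (hx : G.cover (x.eval M)) :
    (stateLabel s x).eval M = labelOf G L (s.eval M) (x.eval M) := by
  have h1 := h.eval_labelCode hs
  rw [stateLabel, Term.eval_label, h1, h.pow _ (h.cover_lt _ hx).le, h.base]
  · rfl
  · rw [h1, h.lim]
    exact (Nat.mod_le _ _).trans hs.le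

theorem Ready.eval_mul_radix (h : Ready G k L M) :
    (mul LocDom.radix LocDom.radix).eval M = L * L := by
  rw [eval_mul, h.eval_radix, min_eq_left h.le_lim.2.1]

theorem Ready.eval_omit (h : Ready G k L M) (hs : s.eval M < L * (L * (L * L))) :
    (LocDom.omitCount s).eval M = omittedOf L (s.eval M) := by
  have hs' : s.eval M ≤ M.lim := by rw [h.lim]; exact hs.le
  rw [LocDom.omitCount, eval_mod_of_le, eval_div_of_le hs', h.eval_radix,
    h.eval_mul_radix, omittedOf]
  rw [eval_div_of_le hs']
  exact (Nat.div_le_self _ _).trans hs'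

theorem Ready.eval_index (h : Ready G k L M) (hs : s.eval M < L * (L * (L * L))) :
    (index s).eval M = indexOf L (s.eval M) := by
  rw [index, eval_div_of_le (by rw [h.lim]; exact hs.le), eval_mul, h.eval_mul_radix,
    h.eval_radix, min_eq_left h.le_lim.2.2, indexOf]

theorem Ready.holds_inSol (h : Ready G k L M) (hs : s.eval M < L * (L * (L * L))) :
    (inSol s x).Holds M ↔ G.cover (x.eval M) ∧ guessOf G L (s.eval M) (x.eval M) = 1 := by
  rw [inSol, holds_and, h.holds_cov, holds_eq, eval_const]
  exact and_congr_right fun hx => by rw [h.eval_guessLabel hs hx]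

theorem Ready.holds_notInSol (h : Ready G k L M) (hs : s.eval M < L * (L * (L * L))) :
    (notInSol s x).Holds M ↔ G.cover (x.eval M) ∧ guessOf G L (s.eval M) (x.eval M) ≠ 1 := by
  rw [notInSol, holds_and, h.holds_cov, holds_not, holds_eq, eval_const]
  exact and_congr_right fun hx => by rw [h.eval_guessLabel hs hx]

theorem Ready.holds_demanded (h : Ready G k L M) (hs : s.eval M < L * (L * (L * L))) :
    (demanded s x).Holds M ↔ G.cover (x.eval M) ∧ guessOf G L (s.eval M) (x.eval M) = 2 := by
  rw [demanded, holds_and, h.holds_cov, holds_eq, eval_const]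
  exact and_congr_right fun hx => by rw [h.eval_guessLabel hs hx]

theorem Ready.holds_touched (h : Ready G k L M) (hs : s.eval M < L * (L * (L * L))) :
    (touched s x).Holds M ↔ G.cover (x.eval M) ∧ labelOf G L (s.eval M) (x.eval M) ≠ 0 := by
  rw [touched, holds_and, h.holds_cov, holds_not, holds_eq, eval_const]
  exact and_congr_right fun hx => by rw [h.eval_stateLabel hs hx]

theorem Ready.holds_separated (h : Ready G k L M) (hs : s.eval M < L * (L * (L * L))) :
    (separated s x y).Holds M ↔ G.cover (x.eval M) ∧ G.cover (y.eval M) ∧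
      labelOf G L (s.eval M) (x.eval M) ≠ labelOf G L (s.eval M) (y.eval M) := by
  rw [separated, holds_and, holds_and, h.holds_cov, h.holds_cov, holds_not, holds_eq]
  exact and_congr_right fun hx => and_congr_right fun hy => by
    rw [h.eval_stateLabel hs hx, h.eval_stateLabel hs hy]

variable {σ τ : ℕ}

theorem Ready.holds_same {u v : Term} (h : Ready G k L M) (hs : σ < L * (L * (L * L)))
    (hσ : ∀ i, s.eval (M.bind 7 i) = σ) (hu : ∀ i, u.eval (M.bind 7 i) = u.eval M)
    (hv : ∀ i, v.eval (M.bind 7 i) = v.eval M) :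
    (same s u v).Holds M ↔ G.Same (guessOf G L σ) (u.eval M) (v.eval M) := by
  have h' := fun i => (ready_bind_iff (x := 7) (v := i)).2 h
  simp only [same, h.holds_allV, holds_imp, holds_iff_term, (h' _).holds_adj]
  refine forall_congr' fun i => forall_congr' fun _ => ?_
  rw [(h' i).holds_inSol (by rwa [hσ]), hσ, and_imp, hu, hv]
  simp

theorem Ready.holds_inClass {v : ℕ} (h : Ready G k L M) (hs : σ < L * (L * (L * L)))
    {a b : ℕ} (hσ : M.env a = σ) (ha : a < 6) (hv : M.env b = v) (hb : b < 6)
    (hj : indexOf L σ < G.n) :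
    (inClass (var a) (var b)).Holds M ↔ G.InClass (guessOf G L σ) (indexOf L σ) v := by
  have h6 := fun i => (ready_bind_iff (x := 6) (v := i)).2 h
  have h7 := fun i => (ready_bind_iff (x := 7) (v := i)).2 h
  have h67 := fun i j => (ready_bind_iff (x := 7) (v := j)).2 (h6 i)
  have a6 : a ≠ 6 := by omega
  have a7 : a ≠ 7 := by omega
  have b6 : b ≠ 6 := by omega
  have b7 : b ≠ 7 := by omega
  have e0 : (index (var a)).eval M = indexOf L σ := by
    rw [h.eval_index (by simpa [hσ])]; simp [hσ]
  have e6 : ∀ i, (index (var a)).eval (M.bind 6 i) = indexOf L σ := fun i => by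
    rw [(h6 i).eval_index (by simpa [hσ, a6])]; simp [hσ, a6]
  have e7 : ∀ i, (index (var a)).eval (M.bind 7 i) = indexOf L σ := fun i => by
    rw [(h7 i).eval_index (by simpa [hσ, a7])]; simp [hσ, a7]
  have e67 : ∀ i j, (index (var a)).eval ((M.bind 6 i).bind 7 j) = indexOf L σ := fun i j => by
    rw [(h67 i j).eval_index (by simpa [hσ, a7, a6])]; simp [hσ, a7, a6]
  rw [inClass, holds_and, holds_and, holds_and, holds_lt, holds_not, h.holds_cov, h.eval_order,
    h.holds_same hs (by simp [hσ, a7]) (by simp [b7]) (by simp [e7, e0]), h.holds_allV, eval_var,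
    hv, e0, CoveredGraph.InClass]
  refine and_congr_right fun _ => and_congr_right fun _ => and_congr_right fun _ => ?_
  have hh : ∀ i, (same (var a) (var 6) (index (var a))).Holds (M.bind 6 i) ↔
      G.Same (guessOf G L σ) i (indexOf L σ) := fun i => by
    rw [(h6 i).holds_same hs (by simp [hσ, a7, a6]) (by simp) (by simp [e67, e6])]
    simp [e6]
  simp only [holds_imp, holds_not, holds_lt, eval_var, Mem.bind_env, if_true, e6, hh]
  exact forall_congr' fun i => ⟨fun H hi => H (hi.trans hj) hi, fun H _ hi => H hi⟩

theorem Ready.holds_omittable {v : ℕ} (h : Ready G k L M) (hs : σ < L * (L * (L * L)))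
    (h1 : M.env 1 = σ) (h2 : M.env 2 = v) :
    (omittable (var 1) (var 2)).Holds M ↔ G.Omittable (guessOf G L σ) v := by
  have h5 := fun i => (ready_bind_iff (x := 5) (v := i)).2 h
  have h3 := fun i => (ready_bind_iff (x := 3) (v := i)).2 h
  rw [omittable, holds_and, h.holds_exV, h.holds_allV]
  refine and_congr (exists_congr fun i => and_congr_right fun hi => ?_)
    (forall_congr' fun i => forall_congr' fun hi => ?_)
  · rw [holds_and, (h5 i).holds_inSol (by simpa [h1]), (h5 i).holds_adj]
    simp [h1, h2, and_assoc]
  · rw [holds_imp, holds_imp, (h3 i).holds_notInSol (by simpa [h1]),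
      (h3 i).holds_same hs (by simp [h1]) (by simp) (by simp),
      (h3 i).holds_demanded (by simpa [h1])]
    simp only [eval_var, Mem.bind_env, h1, h2]
    simp only [if_true, OfNat.one_ne_ofNat, if_false, Nat.reduceEqDiff, and_imp]
    exact ⟨fun H a b c => (H a b c).2, fun H a b c => ⟨a, H a b c⟩⟩

theorem Ready.holds_follows (h : Ready G k L M) (hs : σ < L * (L * (L * L)))
    (ht : τ < L * (L * (L * L))) (h0 : M.env 0 = σ) (h1 : M.env 1 = τ) :
    follows.Holds M ↔ Follows G L τ σ := by
  have hlim := h.le_lim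
  simp only [follows, holds_and, holds_eq, holds_lt, holds_ex, eval_add, eval_const]
  rw [h.eval_guessCode (by simpa [h0]), h.eval_guessCode (by simpa [h1]),
    h.eval_index (by simpa [h0]), h.eval_index (by simpa [h1]), h.eval_order]
  simp only [eval_var, h0, h1]
  refine and_congr_right fun _ => and_congr_right fun _ => and_congr_right fun hj => ?_
  rw [CoveredGraph.Step]
  refine exists_congr fun e => ?_
  have h2 := (ready_bind_iff (x := 2) (v := e)).2 h
  have h3 := fun i => (ready_bind_iff (x := 3) (v := i)).2 h2
  have h4 := fun i j => (ready_bind_iff (x := 4) (v := j)).2 (h3 i)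
  have h5 := fun i j => (ready_bind_iff (x := 5) (v := j)).2 (h3 i)
  have h45 := fun i j l => (ready_bind_iff (x := 5) (v := l)).2 (h4 i j)
  rw [h2.eval_order, Mem.bind_env, if_pos rfl, Nat.lt_succ_iff, ← and_assoc, ← and_assoc]
  have hle : e < M.lim ∧ e ≤ G.n ↔ e ≤ G.n := ⟨fun h => h.2, fun h => ⟨by omega, h⟩⟩
  rw [hle, and_assoc]
  refine and_congr_right fun _ => and_congr ?_ (and_congr ?_ ?_)
  · rw [holds_or, holds_and, holds_and, holds_and, holds_eq, holds_eq, holds_eq, eval_add,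
      h2.eval_omit (by simpa [h0]), h2.eval_omit (by simpa [h1]), h2.eval_order,
      h2.holds_inClass ht (v := e) (by simpa) (by simp) (by simp) (by simp) hj,
      h2.holds_omittable ht (v := e) (by simpa) (by simp)]
    simp [h0, h1]
  · rw [h2.holds_allV]
    refine forall_congr' fun i => forall_congr' fun _ => ?_
    rw [holds_imp, holds_or, (h3 i).holds_touched (by simpa [h0]),
      (h3 i).holds_touched (by simpa [h1]), (h3 i).holds_exV]
    have hh : ∀ w, (and (inClass (var 1) (var 5)) (and (not (eq (var 5) (var 2)))
        (LocDom.adj (var 5) (var 3)))).Holds (((M.bind 2 e).bind 3 i).bind 5 w) ↔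
        G.InClass (guessOf G L τ) (indexOf L τ) w ∧ w ≠ e ∧ G.adj w i := fun w => by
      rw [holds_and, holds_and, (h5 i w).holds_inClass ht (v := w) (by simpa) (by simp) (by simp)
        (by simp) hj, (h5 i w).holds_adj, holds_not, holds_eq]
      simp
    simp only [hh, eval_var, Mem.bind_env, if_true]
    simp only [h0, h1, OfNat.zero_ne_ofNat, OfNat.one_ne_ofNat, if_false, and_imp]
    exact forall_congr' fun hc => by simp [hc]
  · rw [h2.holds_allV]
    simp only [(h3 _).holds_allV]
    refine forall_congr' fun i => forall_congr' fun _ => ?_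
    have hh : ∀ j w, (and (inClass (var 1) (var 5)) (and (not (eq (var 5) (var 2)))
        (not (iff (LocDom.adj (var 5) (var 3)) (LocDom.adj (var 5) (var 4)))))).Holds
          ((((M.bind 2 e).bind 3 i).bind 4 j).bind 5 w) ↔
        G.InClass (guessOf G L τ) (indexOf L τ) w ∧ w ≠ e ∧ ¬ (G.adj w i ↔ G.adj w j) :=
        fun j w => by
      rw [holds_and, holds_and, (h45 i j w).holds_inClass ht (v := w) (by simpa) (by simp)
        (by simp) (by simp) hj, holds_not, holds_not, holds_iff_term, (h45 i j w).holds_adj,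
        (h45 i j w).holds_adj, holds_eq]
      simp
    have hh' : ∀ j, (imp (separated (var 0) (var 3) (var 4))
      (or (separated (var 1) (var 3) (var 4))
        (exV 5 (and (inClass (var 1) (var 5)) (and (not (eq (var 5) (var 2)))
          (not (iff (LocDom.adj (var 5) (var 3)) (LocDom.adj (var 5) (var 4))))))))).Holds
          (((M.bind 2 e).bind 3 i).bind 4 j) ↔ (G.cover i → G.cover j →
            labelOf G L σ i ≠ labelOf G L σ j → labelOf G L τ i ≠ labelOf G L τ j ∨
            ∃ w < G.n, G.InClass (guessOf G L τ) (indexOf L τ) w ∧ w ≠ e ∧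
              ¬ (G.adj w i ↔ G.adj w j)) := fun j => by
      rw [holds_imp, holds_or, (h4 i j).holds_separated (by simpa [h0]),
        (h4 i j).holds_separated (by simpa [h1]), (h4 i j).holds_exV]
      simp only [hh, eval_var, Mem.bind_env, if_true]
      simp only [h0, h1, OfNat.zero_ne_ofNat, OfNat.one_ne_ofNat, if_false, Nat.reduceEqDiff,
        and_imp]
      exact forall_congr' fun hc => forall_congr' fun hc' => by simp [hc, hc']
    simp only [hh']
    exact ⟨fun H hc j hj hcj => H j hj hc hcj, fun H j hj hc hcj => H hc j hj hcj⟩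

theorem Ready.holds_accepts (h : Ready G k L M) (hs : σ < L * (L * (L * L)))
    (h0 : M.env 0 = σ) :
    accepts.Holds M ↔ G.Accepts (guessOf G L σ) k (omittedOf L σ) (labelOf G L σ) := by
  have hlim := h.le_lim
  have h3 := fun i => (ready_bind_iff (x := 3) (v := i)).2 h
  have h4 := fun i j => (ready_bind_iff (x := 4) (v := j)).2 (h3 i)
  have h5 := fun i j => (ready_bind_iff (x := 5) (v := j)).2 (h3 i)
  have hnot : ∀ i, (notInSol (var 0) (var 3)).Holds (M.bind 3 i) ↔
      G.cover i ∧ guessOf G L σ i ≠ 1 := fun i => by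
    rw [(h3 i).holds_notInSol (by simpa [h0])]
    simp [h0]
  rw [accepts, holds_and, holds_and, holds_eq, eval_add, eval_add, h.eval_omit (by simpa [h0]),
    h.eval_order, show LocDom.size.eval M = k from h.size, eval_var, h0, eval_count,
    h.holds_allV, h.holds_allV, CoveredGraph.Accepts]
  refine and_congr ?_ (and_congr ?_ ?_)
  · simp only [holds_and, holds_lt, hnot, (h3 _).eval_order, eval_var, Mem.bind_env, if_true]
    rw [iff_iff_eq]
    congr 3
    congr 1
    ext i
    simp only [Finset.mem_filter, Finset.mem_range]
    exact ⟨fun h => h.2, fun h => ⟨by omega, h⟩⟩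
  · refine forall_congr' fun i => forall_congr' fun _ => ?_
    rw [holds_imp, hnot, and_imp]
    refine forall_congr' fun hc => forall_congr' fun _ => ?_
    have hh : ∀ w, (and (inSol (var 0) (var 5)) (LocDom.adj (var 3) (var 5))).Holds
        ((M.bind 3 i).bind 5 w) ↔ G.cover w ∧ guessOf G L σ w = 1 ∧ G.adj i w := fun w => by
      rw [holds_and, (h5 i w).holds_inSol (by simpa [h0]), (h5 i w).holds_adj]
      simp [h0, and_assoc]
    rw [holds_and, holds_or, holds_imp, (h3 i).holds_touched (by simpa [h0]),
      (h3 i).holds_demanded (by simpa [h0]), (h3 i).holds_exV]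
    simp only [hh]
    simp [h0, hc]
  · refine forall_congr' fun i => forall_congr' fun _ => ?_
    rw [holds_imp, hnot, and_imp]
    refine forall_congr' fun hc => forall_congr' fun _ => ?_
    rw [(h3 i).holds_allV]
    refine forall_congr' fun j => forall_congr' fun _ => ?_
    rw [holds_imp, (h4 i j).holds_notInSol (by simpa [h0]), and_imp]
    simp only [eval_var, Mem.bind_env, if_true, h0, OfNat.zero_ne_ofNat, if_false]
    refine forall_congr' fun hcj => forall_congr' fun _ => ?_
    rw [holds_imp, holds_or, holds_not, holds_not, (h4 i j).holds_separated (by simpa [h0]),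
      (h4 i j).holds_same hs (by simp [h0]) (by simp) (by simp), holds_eq]
    simp [h0, hc, hcj]

theorem Ready.holds_answer (h : Ready G k L M) :
    answer.Holds ((Cmd.fill 3 0 reachable).run M) ↔ ∃ S : Finset ℕ, S.card = k ∧ G.LocDom S := by
  obtain ⟨f1, f2, f3, -⟩ := Cmd.run_fill 3 0 reachable M
  set M' := (Cmd.fill 3 0 reachable).run M
  have hM' : Ready G k L M' := h.of_eq f1 f2
  have hLr := h.radix
  rw [h.lim] at f3
  have hR : ∀ s < L * (L * (L * L)), M'.arr 3 s ≠ 0 ↔ (s % L = 0 ∧ s / (L * L) = 0) ∨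
      ∃ y < s, M'.arr 3 y ≠ 0 ∧ Follows G L y s := by
    intro s hs
    obtain ⟨N, g1, g2, g3, g4, -, g6⟩ := f3 s hs
    have hN : Ready G k L N := h.of_eq (g1.trans h.lim.symm) g3
    rw [g6, ← holds_iff, reachable, holds_or, holds_and, holds_eq, holds_eq, holds_ex,
      hN.eval_labelCode (by simpa [g2]), eval_div_of_le (by simp [g2, hN.lim, hs.le]),
      hN.eval_mul_radix, hN.lim]
    simp only [eval_var, g2, eval_const, holds_and, holds_lt, holds_get, Mem.bind_env, if_true,
      Mem.bind_arr]
    refine or_congr_right ⟨?_, ?_⟩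
    · rintro ⟨y, hy, hys, hRy, hst⟩
      simp only [zero_ne_one, if_false] at hys
      rw [(ready_bind_iff.2 hN).holds_follows hs hy (by simpa) (by simp)] at hst
      exact ⟨y, hys, by rwa [← g4 y hys], hst⟩
    · rintro ⟨y, hys, hRy, hst⟩
      refine ⟨y, by omega, by simpa [g2], by rwa [g4 y hys], ?_⟩
      rw [(ready_bind_iff.2 hN).holds_follows hs (hys.trans hs) (by simpa) (by simp)]
      exact hst
  rw [← exists_locDom_iff_of_reachable (by omega) (by omega) hR, answer, holds_ex, hM'.lim]
  refine exists_congr fun s => and_congr_right fun hs => ?_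
  have h0 := (ready_bind_iff (x := 0) (v := s)).2 hM'
  rw [holds_and, holds_and, holds_get, holds_eq, h0.eval_index (by simpa), h0.eval_order,
    h0.holds_accepts hs (by simp)]
  simp

end

end RAM.LocDom

/-! ### Preprocessing: matching, vertex cover and powers -/

namespace RAM.LocDom

open Term LDS

/-- The edge from the vertex `0` to `w` can be added to the matching in the array `5`. -/
def eligible (w : Term) : Term :=
  and (lt (var 0) w) <| and (adj (var 0) w) <| all 3 <| imp (lt (var 3) (var 0)) <|
    and (not (eq (get 5 (var 3)) (add w (const 1))))
      (not (eq (get 5 (var 3)) (add (var 0) (const 1))))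

/-- A sum in place of a search: its only possible nonzero summand belongs to the least eligible
partner (`sum_least`). The value is shifted by one, so that `0` means unmatched. -/
def matching : Term :=
  sum 1 (ite (and (eligible (var 1)) (all 2 (imp (lt (var 2) (var 1)) (not (eligible (var 2))))))
    (add (var 1) (const 1)) (const 0))

def matchedVertex : Term :=
  ite (or (get 5 (var 0)) (ex 1 (eq (get 5 (var 1)) (add (var 0) (const 1))))) (const 1) (const 0)

/-- The positional weight of the digit of a vertex. It is multiplied by the base only when a cover
vertex has been passed, which gives the exponent `Nat.count G.cover x`. -/
def weight : Term :=
  ite (var 0)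
    (ite (cov (sub (var 0) (const 1)))
      (mul (get 2 (const 0)) (get 1 (sub (var 0) (const 1))))
      (get 1 (sub (var 0) (const 1))))
    (const 1)

def cmds : List Cmd :=
  [.setLim order,
   .fill 5 0 matching,
   .fill 4 0 matchedVertex,
   -- Large enough for the indices `0` to `n` of the weights and for the base, at most `n + 3`, to
   -- be multiplied without truncation.
   .setLim (add order (const 3)),
   .fill 2 0 (add (count 1 (cov (var 1))) (const 3)),
   .fill 1 0 weight,
   .setLim radix,
   -- The fourth power of the radix: a state has four digits, for labelling, guess, number of
   -- omissions and index.
   .setLim (sum 0 (sum 0 (sum 0 lim))),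
   .fill 3 0 reachable]

variable {n k : ℕ} {a : ℕ → ℕ → Prop} {M : Mem}

theorem holds_eligible {v : ℕ} {w : Term} (hlim : M.lim = n) (h0 : M.arr 0 0 = n)
    (ha : ∀ u < n, ∀ v < n, M.arr 0 (2 + (u * n + v)) ≠ 0 ↔ a u v)
    (hv : M.env 0 = v) (hvn : v < n) (hw : w.eval M < n)
    (hw' : ∀ i, w.eval (M.bind 3 i) = w.eval M) :
    (eligible w).Holds M ↔ v < w.eval M ∧ a v (w.eval M) ∧
      ∀ u < v, M.arr 5 u ≠ w.eval M + 1 ∧ M.arr 5 u ≠ v + 1 := by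
  have hadj : (LocDom.adj (var 0) w).Holds M ↔ a v (w.eval M) := by
    simp only [LocDom.adj, holds_and, holds_lt, order, holds_get, eval_get, eval_add, eval_const,
      eval_mul, eval_var, hv, h0, hlim]
    rw [min_eq_left hvn.le, ha v hvn _ hw]
    exact ⟨fun h => h.2.2, fun h => ⟨hvn, hw, h⟩⟩
  rw [eligible, holds_and, holds_and, hadj, holds_lt, eval_var, hv, holds_all]
  refine and_congr_right fun _ => and_congr_right fun _ => ?_
  simp only [holds_imp, holds_lt, holds_and, holds_not, holds_eq, eval_get, eval_var, eval_add,
    eval_const, hw', Mem.bind_arr, Mem.bind_env, if_true, OfNat.zero_ne_ofNat, if_false, hv, hlim]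
  exact forall_congr' fun u => ⟨fun h hu => h (by omega) hu, fun h _ hu => h hu⟩

theorem eval_matching {v : ℕ} (hlim : M.lim = n) (h0 : M.arr 0 0 = n)
    (ha : ∀ u < n, ∀ v < n, M.arr 0 (2 + (u * n + v)) ≠ 0 ↔ a u v)
    (hv : M.env 0 = v) (hvn : v < n) :
    (matching.eval M = 0 ∧ ∀ w < n,
      ¬ (v < w ∧ a v w ∧ ∀ u < v, M.arr 5 u ≠ w + 1 ∧ M.arr 5 u ≠ v + 1)) ∨
    ∃ w < n, (v < w ∧ a v w ∧ ∀ u < v, M.arr 5 u ≠ w + 1 ∧ M.arr 5 u ≠ v + 1) ∧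
      matching.eval M = w + 1 := by
  classical
  have key : matching.eval M = ∑ w ∈ Finset.range n,
      if (v < w ∧ a v w ∧ ∀ u < v, M.arr 5 u ≠ w + 1 ∧ M.arr 5 u ≠ v + 1) ∧
        ∀ i < w, ¬ (v < i ∧ a v i ∧ ∀ u < v, M.arr 5 u ≠ i + 1 ∧ M.arr 5 u ≠ v + 1)
      then w + 1 else 0 := by
    rw [matching, eval_sum, hlim]
    refine Finset.sum_congr rfl fun w hw => ?_
    rw [Finset.mem_range] at hw
    rw [eval_ite]
    refine if_congr ?_ (by simp) rfl
    rw [holds_and, holds_eligible (M := M.bind 1 w) hlim h0 ha (by simpa) hvn (by simpa)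
      (by simp), holds_all]
    refine and_congr (by simp) ?_
    have : ∀ i < n, (eligible (var 2)).Holds ((M.bind 1 w).bind 2 i) ↔
        (v < i ∧ a v i ∧ ∀ u < v, M.arr 5 u ≠ i + 1 ∧ M.arr 5 u ≠ v + 1) := fun i hi => by
      rw [holds_eligible (M := (M.bind 1 w).bind 2 i) hlim h0 ha (by simpa) hvn (by simpa)
        (by simp)]
      simp
    simp only [holds_imp, holds_lt, holds_not, eval_var, Mem.bind_env, if_true, Mem.bind_lim, hlim,
      OfNat.one_ne_ofNat, if_false]
    exact forall_congr' fun i => ⟨fun h hi => (this i (by omega)).not.1 (h (by omega) hi),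
      fun h hin hi => (this i hin).not.2 (h hi)⟩
  rw [key]
  exact sum_least n _

open Classical in
-- The set `C` is any vertex cover and serves only to bound the memory; the cover used by the
-- program comes from the matching.
theorem runAll_cmds (hlt : ∀ {u v}, a u v → u < n ∧ v < n) (hsymm : ∀ {u v}, a u v → a v u)
    (hirr : ∀ u, ¬ a u u) (hlim : M.lim = 0) (h0 : M.arr 0 0 = n) (h1 : M.arr 0 1 = k)
    (ha : ∀ u < n, ∀ v < n, M.arr 0 (2 + (u * n + v)) ≠ 0 ↔ a u v) (h4 : ∀ i, M.arr 4 i = 0) :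
    (∀ (C : Finset ℕ) (L : ℕ), (∀ u v, a u v → u ∈ C ∨ v ∈ C) →
      (2 * C.card + 3) ^ (2 * C.card) + (n + 1) ≤ L →
      Cmd.LimLe (L * (L * (L * L))) cmds M) ∧
    (answer.Holds (Cmd.runAll cmds M) ↔ ∃ S : Finset ℕ, S.card = k ∧ (∀ v ∈ S, v < n) ∧
      (∀ v < n, v ∈ S ∨ ∃ w ∈ S, a v w) ∧
      ∀ u < n, ∀ v < n, u ∉ S → v ∉ S → u ≠ v → ∃ w ∈ S, ¬ (a u w ↔ a v w)) := by
  set M₁ := (Cmd.setLim order).run M with hM₁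
  have l1 : M₁.lim = n := h0
  obtain ⟨l2, a2, f2, -⟩ := Cmd.run_fill 5 0 matching M₁
  set M₂ := (Cmd.fill 5 0 matching).run M₁
  obtain ⟨l3, a3, f3, f3'⟩ := Cmd.run_fill 4 0 matchedVertex M₂
  set M₃ := (Cmd.fill 4 0 matchedVertex).run M₂
  set M₄ := (Cmd.setLim (add order (const 3))).run M₃ with hM₄
  obtain ⟨l5, a5, f5, -⟩ := Cmd.run_fill 2 0 (add (count 1 (cov (var 1))) (const 3)) M₄
  set M₅ := (Cmd.fill 2 0 (add (count 1 (cov (var 1))) (const 3))).run M₄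
  obtain ⟨l6, a6, f6, -⟩ := Cmd.run_fill 1 0 weight M₅
  set M₆ := (Cmd.fill 1 0 weight).run M₅
  set M₇ := (Cmd.setLim radix).run M₆ with hM₇
  set M₈ := (Cmd.setLim (sum 0 (sum 0 (sum 0 lim)))).run M₇ with hM₈
  have hmatch : GreedyMatching n a (M₂.arr 5) := by
    refine ⟨fun v hv => ?_⟩
    obtain ⟨N, g1, g2, g3, g4, -, g6⟩ := f2 v (by omega)
    have h := eval_matching (M := N) (g1.trans l1) (by rw [g3 0 (by simp)]; exact h0)
      (by rw [g3 0 (by simp)]; exact ha) g2 hv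
    rw [g6]
    have h5 : ∀ w, (∀ u < v, N.arr 5 u ≠ w + 1 ∧ N.arr 5 u ≠ v + 1) ↔
        ∀ u < v, M₂.arr 5 u ≠ w + 1 ∧ M₂.arr 5 u ≠ v + 1 := fun w =>
      forall_congr' fun u => forall_congr' fun hu => by rw [g4 u hu]
    simp only [h5] at h
    exact h
  let G : CoveredGraph :=
    { n := n
      adj := a
      cover := matched n (M₂.arr 5)
      adj_lt := hlt
      adj_symm := hsymm
      isCover := fun {u v} h => by
        rcases lt_trichotomy u v with huv | rfl | huv
        · exact hmatch.isCover (hlt h).1 (hlt h).2 huv h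
        · exact absurd h (hirr u)
        · exact (hmatch.isCover (hlt h).2 (hlt h).1 huv (hsymm h)).symm }
  have hcov : ∀ v, M₃.arr 4 v ≠ 0 ↔ G.cover v := by
    intro v
    change _ ↔ matched n (M₂.arr 5) v
    by_cases hv : v < n
    · obtain ⟨N, g1, g2, g3, -, -, g6⟩ := f3 v (by omega)
      rw [g6]
      simp only [matchedVertex, eval_ite, eval_const, holds_or, holds_get, holds_ex, holds_eq,
        eval_get, eval_add, eval_var, g2, g1, l2, l1, g3 5 (by simp), Mem.bind_arr, Mem.bind_env,
        if_true, zero_ne_one, if_false, matched, hv, true_and]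
      simp [or_iff_not_imp_left]
    · rw [f3' v (by omega), a2 4 (by simp)]
      change M.arr 4 v ≠ 0 ↔ _
      simp [h4, matched, hv]
  have hcovlt : ∀ v, G.cover v → v < G.n := fun v h => h.1
  have e0 : M₈.arr 0 = M.arr 0 := by
    change M₆.arr 0 = M.arr 0
    rw [a6 0 (by simp), a5 0 (by simp)]
    change M₃.arr 0 = _
    rw [a3 0 (by simp), a2 0 (by simp)]
    rfl
  have hcov8 : ∀ v, M₈.arr 4 v ≠ 0 ↔ G.cover v := by
    change ∀ v, M₆.arr 4 v ≠ 0 ↔ _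
    rw [a6 4 (by simp), a5 4 (by simp)]
    exact hcov
  have l4 : M₄.lim = n + 3 := by
    change M₃.arr 0 0 + 3 = n + 3
    rw [a3 0 (by simp), a2 0 (by simp)]
    change M.arr 0 0 + 3 = _
    rw [h0]
  set r := Nat.count G.cover G.n with hr
  have hrn : r ≤ n := Nat.count_le _
  have hbase : M₅.arr 2 0 = r + 3 := by
    obtain ⟨N, g1, -, g3, -, -, g6⟩ := f5 0 (by omega)
    rw [g6, eval_add, eval_count, eval_const, hr, Nat.count_eq_card_filter_range]
    congr 2
    ext i
    simp only [cov, holds_get, Mem.bind_arr, eval_var, Mem.bind_env, if_true, g3 4 (by simp),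
      Finset.mem_filter, Finset.mem_range, g1, l4]
    have := hcov i
    change M₄.arr 4 i ≠ 0 ↔ _ at this
    rw [this]
    exact ⟨fun h => ⟨hcovlt i h.2, h.2⟩, fun h => ⟨by have : i < n := h.1; omega, h.2⟩⟩
  have hpow : ∀ x ≤ G.n, M₆.arr 1 x = (r + 3) ^ Nat.count G.cover x := by
    intro x
    induction x with
    | zero =>
      intro _
      obtain ⟨N, g1, g2, -, -, -, g6⟩ := f6 0 (by omega)
      rw [g6]
      simp [weight, g2, Term.holds_iff]
    | succ x ih =>
      intro hx
      have hx' : x + 1 ≤ n := hx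
      obtain ⟨N, g1, g2, g3, g4, -, g6⟩ := f6 (x + 1) (by omega)
      have hc : N.arr 4 x ≠ 0 ↔ G.cover x := by
        rw [g3 4 (by simp), a5 4 (by simp)]
        exact hcov x
      have hne : (var 0).Holds N := by rw [Term.holds_iff, eval_var, g2]; omega
      rw [g6, weight, eval_ite, if_pos hne, eval_ite]
      simp only [cov, holds_get, eval_mul, eval_sub, eval_get, eval_var, eval_const, g2,
        Nat.add_sub_cancel, hc, g3 2 (by simp), hbase, g1, l5, l4, g4 x (by omega), ih (by omega)]
      rw [min_eq_left (by omega), Nat.count_succ]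
      split_ifs
      · rw [pow_succ']
      · rfl
  set L := (r + 3) ^ r + (n + 1) with hL
  have l7 : M₇.lim = L := by
    change M₆.arr 1 (M₆.arr 0 0) + (M₆.arr 0 0 + 1) = L
    rw [show M₆.arr 0 0 = n by rw [show M₆.arr 0 = M.arr 0 from e0, h0], hpow n le_rfl]
  have l8 : M₈.lim = L * (L * (L * L)) := by
    simp [hM₈, Cmd.run, l7]
  have hready : Ready G k L M₈ :=
    ⟨l8, by rw [e0]; exact h0, by rw [e0]; exact h1, by rw [e0]; exact ha, hcov8, hcovlt, hpow,
      (by rw [← hbase, ← a6 2 (by simp)]; rfl), hL⟩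
  refine ⟨fun C L' hC hL' => ?_, ?_⟩
  · have hrC : r ≤ 2 * C.card := hmatch.count_le C hC
    have hLL : L ≤ L' := by
      refine le_trans ?_ hL'
      rw [hL]
      gcongr
      · omega
    have hpos : 0 < (r + 3) ^ r := by positivity
    have key : L' ≤ L' * (L' * L') := Nat.le_mul_of_pos_right _ (Nat.mul_pos (by omega) (by omega))
    -- The intermediate bound `n + 3` may exceed `L'`, which is only known to be at least `n + 2`,
    -- but not `L' * 2`.
    have key' : L' * 2 ≤ L' * (L' * (L' * L')) := Nat.mul_le_mul le_rfl (by omega)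
    refine ⟨hlim.le.trans (by omega), l1.le.trans (by omega), (l2.trans l1).le.trans (by omega),
      (l3.trans (l2.trans l1)).le.trans (by omega), ?_, ?_, ?_, l7.le.trans (by omega), ?_, ?_⟩
    · exact l4.le.trans (by omega)
    · exact (l5.trans l4).le.trans (by omega)
    · exact (l6.trans (l5.trans l4)).le.trans (by omega)
    · rw [l8]
      gcongr
    · refine ((Cmd.run_fill 3 0 reachable M₈).1.trans l8).le.trans ?_
      gcongr
  · have hrun : Cmd.runAll cmds M = (Cmd.fill 3 0 reachable).run M₈ := rfl
    rw [hrun]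
    refine hready.holds_answer.trans (exists_congr fun S => and_congr_right fun _ => ?_)
    exact ⟨fun h => ⟨h.lt, h.dom, h.loc⟩, fun h => ⟨h.1, h.2.1, h.2.2⟩⟩

end RAM.LocDom

/-! ### Running time and correctness for Locating-Dominating Set -/

namespace RAM.LocDom

theorem lim_le (v n : ℕ) : ((2 * v + 3) ^ (2 * v) + (n + 1)) * (((2 * v + 3) ^ (2 * v) + (n + 1)) *
    (((2 * v + 3) ^ (2 * v) + (n + 1)) * ((2 * v + 3) ^ (2 * v) + (n + 1)))) + 1 ≤
    (26 ^ 4 + 1) * (v ^ v) ^ 24 * (n + 1) ^ 4 := by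
  have hV : 1 ≤ v ^ v := Nat.pow_self_pos
  -- For `v ≥ 2` this follows from `2 * v + 3 ≤ v ^ 3`; the value at `v = 1` is `25`.
  have h : (2 * v + 3) ^ (2 * v) ≤ 25 * (v ^ v) ^ 6 := by
    rcases v with _ | _ | v
    · simp
    · simp
    · calc (2 * (v + 2) + 3) ^ (2 * (v + 2)) ≤ ((v + 2) ^ 3) ^ (2 * (v + 2)) := by
            gcongr
            nlinarith [sq_nonneg v, Nat.zero_le (v ^ 3)]
        _ = ((v + 2) ^ (v + 2)) ^ 6 := by rw [← pow_mul, ← pow_mul]; ring_nf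
        _ ≤ _ := Nat.le_mul_of_pos_left _ (by norm_num)
  have hV6 : 1 ≤ (v ^ v) ^ 6 := Nat.one_le_pow _ _ hV
  set V := v ^ v
  have h1 : (2 * v + 3) ^ (2 * v) + (n + 1) ≤ 26 * V ^ 6 * (n + 1) := by
    nlinarith [Nat.mul_le_mul_right n hV6]
  have h2 : 1 ≤ V ^ 24 * (n + 1) ^ 4 := Nat.mul_pos (Nat.pow_pos hV) (by positivity)
  set L := (2 * v + 3) ^ (2 * v) + (n + 1)
  calc L * (L * (L * L)) + 1 = L ^ 4 + 1 := by ring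
    _ ≤ (26 * V ^ 6 * (n + 1)) ^ 4 + V ^ 24 * (n + 1) ^ 4 := by gcongr
    _ = _ := by ring

/-- The adjacency relation of a graph on `Fin n`, as a relation between natural numbers. -/
def natAdj {n : ℕ} (G : SimpleGraph (Fin n)) (u v : ℕ) : Prop :=
  ∃ (hu : u < n) (hv : v < n), G.Adj ⟨u, hu⟩ ⟨v, hv⟩

theorem locatingDominatingSet_iff {n : ℕ} (G : SimpleGraph (Fin n)) (k : ℕ) :
    (∃ S : Finset ℕ, S.card = k ∧ (∀ v ∈ S, v < n) ∧
      (∀ v < n, v ∈ S ∨ ∃ w ∈ S, natAdj G v w) ∧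
      ∀ u < n, ∀ v < n, u ∉ S → v ∉ S → u ≠ v → ∃ w ∈ S, ¬ (natAdj G u w ↔ natAdj G v w)) ↔
    LocatingDominatingSet G k := by
  constructor
  · rintro ⟨S, h1, h2, h3, h4⟩
    refine ⟨S.attachFin h2, by simpa, fun v => ?_, fun u v hu hv huv heq => ?_⟩
    · rcases h3 v v.2 with h | ⟨w, hw, hv, hw', h⟩
      · exact .inl (by simpa)
      · exact .inr ⟨⟨w, hw'⟩, by simpa, h⟩
    · obtain ⟨w, hw, h⟩ := h4 u u.2 v v.2 (by simpa using hu) (by simpa using hv)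
        (by simpa [Fin.ext_iff] using huv)
      have := Set.ext_iff.1 heq ⟨w, h2 w hw⟩
      simp only [Set.mem_inter_iff, SimpleGraph.mem_neighborSet, SetLike.mem_coe,
        Finset.mem_attachFin, hw, and_true] at this
      exact h (by simpa [natAdj, h2 w hw] using this)
  · rintro ⟨S, h1, h2, h3⟩
    have hmem : ∀ w (hw : w < n), w ∈ S.map Fin.valEmbedding ↔ (⟨w, hw⟩ : Fin n) ∈ S :=
      fun w hw => by
        rw [Finset.mem_map]
        exact ⟨fun ⟨x, hx, h⟩ => by
          obtain rfl : x = ⟨w, hw⟩ := Fin.ext h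
          exact hx, fun h => ⟨_, h, rfl⟩⟩
    refine ⟨S.map Fin.valEmbedding, by simpa, by simp, fun v hv => ?_,
      fun u hu v hv huS hvS huv => ?_⟩
    · rcases h2 ⟨v, hv⟩ with h | ⟨w, hw, h⟩
      · exact .inl ((hmem v hv).2 h)
      · exact .inr ⟨w, (hmem w w.2).2 hw, hv, w.2, h⟩
    · rw [hmem _ hu] at huS
      rw [hmem _ hv] at hvS
      by_contra! hcon
      refine h3 ⟨u, hu⟩ ⟨v, hv⟩ huS hvS (by simpa) (Set.ext fun w => ?_)
      rw [Set.mem_inter_iff, Set.mem_inter_iff]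
      refine and_congr_left fun hw => ?_
      have := hcon w ((hmem w w.2).2 hw)
      simpa [natAdj, hu, hv] using this

theorem exists_prog : ∃ (P : Prog) (c : ℕ), ∀ (n : ℕ) (G : SimpleGraph (Fin n)) (k vc : ℕ),
    G.vertexCoverNum = (vc : ℕ∞) →
    P.DecidesInTime (ldsInput G k) (LocatingDominatingSet G k)
      ((c : ℝ) * (2 : ℝ) ^ ((c : ℝ) * ((vc : ℝ) * Real.logb 2 (vc : ℝ))) *
        ((n : ℝ) + 1) ^ c) := by
  classical
  obtain ⟨K, hK⟩ := Cmd.exists_toProg_ends cmds (.ite answer (.const 1) (.const 0))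
  obtain ⟨c, hc⟩ := exists_time_bound K (26 ^ 4 + 1) 24 4
  refine ⟨Cmd.toProg cmds (.ite answer (.const 1) (.const 0)), c, fun n G k vc hvc => ?_⟩
  obtain ⟨h1, h2⟩ := runAll_cmds (n := n) (k := k) (a := natAdj G)
    (M := (State.init (ldsInput G k)).mem) (fun ⟨hu, hv, _⟩ => ⟨hu, hv⟩)
    (fun ⟨hu, hv, h⟩ => ⟨hv, hu, h.symm⟩)
    (fun u ⟨hu, _, h⟩ => G.loopless.irrefl _ h) rfl rfl rfl (by
      intro u hu v hv
      have hlt : u * n + v < n * n := by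
        calc u * n + v < (u + 1) * n := by rw [Nat.add_mul]; omega
          _ ≤ n * n := by gcongr; omega
      have h1 : (u * n + v) / n = u := by
        rw [mul_comm, Nat.mul_add_div (by omega), Nat.div_eq_of_lt hv, add_zero]
      have h2 : (u * n + v) % n = v := by
        rw [mul_comm, Nat.mul_add_mod, Nat.mod_eq_of_lt hv]
      rw [add_comm 2]
      simp [State.mem, State.init, ldsInput, List.getD_eq_getElem?_getD, hlt, Fin.divNat,
        Fin.modNat, h1, h2, natAdj, hu, hv]) fun i => rfl
  rw [locatingDominatingSet_iff] at h2
  -- A minimum vertex cover enters only here, in the analysis of the time.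
  obtain ⟨C, hC, hcover⟩ := G.vertexCoverNum_exists
  rw [hvc] at hC
  have hCfin : C.toFinset.card = vc := by
    rw [Set.encard_eq_coe_toFinset_card] at hC
    exact_mod_cast hC
  have hcov : ∀ u v, natAdj G u v → u ∈ C.toFinset.map Fin.valEmbedding ∨
      v ∈ C.toFinset.map Fin.valEmbedding := by
    rintro u v ⟨hu, hv, h⟩
    exact (hcover h).imp
      (fun h => Finset.mem_map_of_mem Fin.valEmbedding (Set.mem_toFinset.2 h))
      (fun h => Finset.mem_map_of_mem Fin.valEmbedding (Set.mem_toFinset.2 h))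
  obtain ⟨t, s', h3, h4, h5⟩ := hK _ _ (h1 _ _ hcov le_rfl)
  rw [Finset.card_map, hCfin] at h4
  refine ⟨t, s', h3, ?_, fun h => ?_, fun h => ?_⟩
  · exact_mod_cast hc vc n _ t (lim_le vc n) h4
  · rw [h5, Term.eval_ite, if_pos (h2.2 h)]; rfl
  · rw [h5, Term.eval_ite, if_neg (h2.not.2 h)]; rfl

end RAM.LocDom

theorem theorem1 :
    (∃ (P : RAM.Prog) (c : ℕ), ∀ (n : ℕ) (G : SimpleGraph (Fin n)) (k vc : ℕ),
      G.vertexCoverNum = (vc : ℕ∞) →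
      P.DecidesInTime (ldsInput G k) (LocatingDominatingSet G k)
        ((c : ℝ) * (2 : ℝ) ^ ((c : ℝ) * ((vc : ℝ) * Real.logb 2 (vc : ℝ))) *
          ((n : ℝ) + 1) ^ c)) ∧
    (∃ (P : RAM.Prog) (c : ℕ), ∀ (u m : ℕ) (F : Fin m → Finset (Fin u)) (k : ℕ),
      P.DecidesInTime (testCoverInput F k) (TestCover F k)
        ((c : ℝ) * (2 : ℝ) ^ ((c : ℝ) * ((u : ℝ) * Real.logb 2 (u : ℝ))) *
          ((u : ℝ) + (m : ℝ) + 1) ^ c)) :=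
  ⟨RAM.LocDom.exists_prog, RAM.TestCover.exists_prog⟩
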